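/- All digraphs are finite and simple, and a dag is a digraph without directed cycles. For a digraph $G$ and a permutation (linear ordering) $\pi$ of its vertices, $G_L(\pi)$ is the spanning subgraph of $G$ whose edges are the edges $(u,v)$ of $G$ with $\pi(u)<\pi(v)$; these are the edges covered by $\pi$. The skewness of a digraph $H$ is $s(H)=\min_C\max_\pi |E(H_L(\pi))|$, where $C$ ranges over all vertex colorings of $H$ and $\pi$ over all permutations of $V(H)$ in which the vertices of each color of $C$ are consecutive. The fractional arboricity of $H$ is $a(H)=\max |E(H')|/(|V(H')|-1)$ over all subgraphs $H'$ of $H$ with at least two vertices. A rooted star is a star whose center is a source or a sink. An $H$-copy in $G$ is a subgraph of $G$ isomorphic to $H$. $\vec G(n,p)$ is the random digraph on $[n]$ in which each ordered pair of distinct vertices is an edge with probability $p$, independently. Theorem. There is an absolute constant $K$ such that the following holds. Let $H$ be a dag with $h$ vertices and $m\ge 2$ edges, without isolated vertices, which is not a rooted star. Then $$\left|s(H)-\tfrac m2\right|\le K\,m^{4/5}h^{1/5}\quad\text{and}\quad s(H)<m,$$ and for every real $a^*>a(H)$ there is a constant $c^*=c^*(a^*,H)>0$ such that the probability that $G\sim\vec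 G(n,n^{-1/a^*})$ has the following property tends to $1$ as $n\to\infty$: for every set $X$ of at most $c^*\log_2 n$ permutations of $[n]$ there is an $H$-copy in $G$ such that each $\pi\in X$ covers at most $s(H)$ edges of that copy. -/

import Mathlib

open Finset Filter Topology

namespace DagCover

variable {V : Type*}

/-- A directed acyclic graph: no directed cycle (hence no loop and no pair of opposite arcs). -/
def IsDag (H : Digraph V) : Prop :=
  ∀ v, ¬ Relation.TransGen H.Adj v v

/-- `H` is a star whose center `c` is either a source or a sink. -/
def IsRootedStar (H : Digraph V) : Prop :=
  ∃ c, (∀ u v, H.Adj u v ↔ u = c ∧ v ≠ c) ∨ (∀ u v, H.Adj u v ↔ v = c ∧ u ≠ c)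

/-- Every vertex is an endpoint of some arc. -/
def NoIsolatedVertex (H : Digraph V) : Prop :=
  ∀ v, ∃ u, H.Adj u v ∨ H.Adj v u

open Classical in
/-- The edge set `E(H)`. -/
noncomputable def arcs [Fintype V] (H : Digraph V) : Finset (V × V) :=
  {e : V × V | H.Adj e.1 e.2}

/-- The fractional arboricity `a(H)`: the maximum of `|E(H')| / (|V(H')| - 1)` over all subgraphs
`H' = (S, F)` of `H` with at least two vertices. -/
noncomputable def fracArboricity [Fintype V] (H : Digraph V) : ℝ :=
  sSup {x : ℝ | ∃ (S : Finset V) (F : Finset (V × V)), 2 ≤ #S ∧ F ⊆ arcs H ∧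
    (∀ e ∈ F, e.1 ∈ S ∧ e.2 ∈ S) ∧ x = (#F : ℝ) / ((#S : ℝ) - 1)}

/-- The spanning subgraph `G_L(π)` consisting of the arcs of `G` that go from left to right in the
ordering of the vertices in which the vertex `v` stands at position `π v`. -/
def leftGraph (G : Digraph V) {k : ℕ} (π : V ≃ Fin k) : Digraph V where
  Adj u v := G.Adj u v ∧ π u < π v

/-- The permutation `π` respects the coloring `C`: in the ordering given by `π`, the vertices of
any given color are consecutive. -/
def Respects {k : ℕ} (π : V ≃ Fin k) (C : V → ℕ) : Prop :=
  ∀ u v w, π u < π v → π v < π w → C u = C w → C v = C u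

open Classical in
/-- `s_H(C)`: the maximum of `|E(H_L(π))|` over all permutations `π` of `V(H)` respecting `C`. -/
noncomputable def coloringSkewness [Fintype V] (H : Digraph V) (C : V → ℕ) : ℕ :=
  ({π : V ≃ Fin (Fintype.card V) | Respects π C} : Finset _).sup fun π => #(arcs (leftGraph H π))

/-- The skewness `s(H)`: the minimum of `s_H(C)` over all vertex colorings `C`. -/
noncomputable def skewness [Fintype V] (H : Digraph V) : ℕ :=
  ⨅ C : V → ℕ, coloringSkewness H C

/-- A labeled `H`-copy in `G`: an injective map of vertices that preserves arcs. Its vertices and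
arcs are the images of those of `H`. -/
structure Copy {W : Type*} (H : Digraph V) (G : Digraph W) where
  /-- The underlying injection. -/
  toEmb : V ↪ W
  /-- Arcs are sent to arcs. -/
  map_adj : ∀ u v, H.Adj u v → G.Adj (toEmb u) (toEmb v)

/-- The arcs of an `H`-copy. -/
noncomputable def Copy.arcs [Fintype V] {W : Type*} {H : Digraph V} {G : Digraph W}
    (φ : Copy H G) : Finset (W × W) :=
  (DagCover.arcs H).map (φ.toEmb.prodMap φ.toEmb)

open Classical in
/-- The number of arcs of an `H`-copy in `G` that are covered by (i.e. lie in `G_L` of) the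
permutation `π`. -/
noncomputable def Copy.numCovered [Fintype V] {n : ℕ} {H : Digraph V} {G : Digraph (Fin n)}
    (φ : Copy H G) (π : Equiv.Perm (Fin n)) : ℕ :=
  #(φ.arcs ∩ DagCover.arcs (leftGraph G π))

/-- The digraph on `Fin n` with a given set of arcs. -/
def ofArcs {n : ℕ} (E : Finset (Fin n × Fin n)) : Digraph (Fin n) where
  Adj i j := (i, j) ∈ E

open Classical in
/-- The probability that the random digraph on `n` vertices, in which each ordered pair of distinct
vertices is an arc with probability `p` independently of all others, has the property `P`. -/
noncomputable def randDigraphProb (n : ℕ) (p : ℝ) (P : Digraph (Fin n) → Prop) : ℝ :=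
  ∑ E ∈ (univ : Finset (Fin n)).offDiag.powerset with P (ofArcs E),
    ∏ e ∈ (univ : Finset (Fin n)).offDiag, if e ∈ E then p else 1 - p

end DagCover

namespace DagCover

/-! ### Skewness: the lower bound m/2 and strictness below m. -/

section

variable {V : Type*}

/-! Write m and h for the numbers of arcs and vertices of H.

Size of the skewness. Reversing an ordering preserves the consecutive-colors condition and covers
exactly the arcs missed before, so s(H) ≥ m/2. For the upper bound, in an ordering with consecutive
color classes the covered arcs between two classes all go one way. Hence at most m/2 arcs are
covered, plus errors from monochromatic arcs and from the imbalance between the two directions for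
each pair of classes. A uniformly random k-coloring keeps both errors small on average, because
disjoint arcs contribute nothing to the expected squared imbalance (`exists_balanced_coloring`).
Strictness comes from an explicit 2-coloring based on a directed path of length two or on two
disjoint arcs; if neither exists, H is a rooted star.

Random digraph. Fix a coloring C attaining s(H). Repeated halving produces, for any X of size at
most a small multiple of log n, disjoint vertex blocks of size N = ⌈n^(1-δ)⌉, one per vertex of H,
such that every π in X orders every transversal compatibly with C (`exists_blocks_respecting`). A
copy of H that is transversal to these blocks is therefore covered in at most s(H) arcs by each π.
It remains to find such a copy for all block families at once. Janson's inequality on a random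
subfamily of the transversals bounds the failure probability of one family by exp(-Ω(n^(1+ε))):
since a > a(H), every subset of at least two vertices of H has at least n^(1+ε) expected transversal
copies of the subgraph it induces. There are at most n^(hN) ≤ exp(h n log n) block families, so the
union bound closes the argument. -/

theorem mem_arcs [Fintype V] {H : Digraph V} {e : V × V} : e ∈ arcs H ↔ H.Adj e.1 e.2 := by
  simp [arcs]

theorem IsDag.irrefl {H : Digraph V} (hH : IsDag H) (v : V) : ¬ H.Adj v v :=
  fun h => hH v (.single h)

theorem arcs_leftGraph [Fintype V] (H : Digraph V) {k : ℕ} (π : V ≃ Fin k) :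
    arcs (leftGraph H π) = {e ∈ arcs H | π e.1 < π e.2} := by
  ext e
  simp [mem_arcs, leftGraph]

/-- An injection of a finite type into a linear order induces an enumeration in the same order. -/
theorem exists_equiv_fin_lt_iff [Fintype V] {L : Type*} [LinearOrder L] (g : V → L)
    (hg : Function.Injective g) :
    ∃ σ : V ≃ Fin (Fintype.card V), ∀ u v, σ u < σ v ↔ g u < g v := by
  let _ : LinearOrder V := LinearOrder.lift' g hg
  refine ⟨(Fintype.orderIsoFinOfCardEq V rfl).symm.toEquiv, fun u v => ?_⟩
  exact (Fintype.orderIsoFinOfCardEq V rfl).symm.lt_iff_lt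

/-- Sort lexicographically by color, breaking ties by an arbitrary enumeration. -/
theorem exists_respects [Fintype V] (C : V → ℕ) :
    ∃ π : V ≃ Fin (Fintype.card V), Respects π C := by
  obtain ⟨σ, hσ⟩ := exists_equiv_fin_lt_iff
    (fun v => toLex (C v, Fintype.equivFin V v)) (fun u v h => by
      have := congrArg (fun x => (ofLex x).2) h
      exact (Fintype.equivFin V).injective this)
  refine ⟨σ, fun u v w huv hvw h => ?_⟩
  rw [hσ, Prod.Lex.toLex_lt_toLex] at huv hvw
  simp only at huv hvw
  omega

theorem Respects.rev {k : ℕ} {π : V ≃ Fin k} {C : V → ℕ} (h : Respects π C) :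
    Respects (π.trans Fin.revPerm) C := by
  intro u v w huv hvw hC
  simp only [Equiv.trans_apply, Fin.revPerm_apply, Fin.rev_lt_rev] at huv hvw
  rw [h w v u hvw huv hC.symm, hC]

theorem card_arcs_leftGraph_le [Fintype V] (H : Digraph V) {C : V → ℕ}
    {π : V ≃ Fin (Fintype.card V)} (h : Respects π C) :
    #(arcs (leftGraph H π)) ≤ coloringSkewness H C := by
  classical
  unfold coloringSkewness
  exact Finset.le_sup (f := fun π : V ≃ Fin (Fintype.card V) => #(arcs (leftGraph H π)))
    (by simpa using h)

theorem coloringSkewness_le [Fintype V] {H : Digraph V} {C : V → ℕ} {B : ℕ}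
    (h : ∀ π : V ≃ Fin (Fintype.card V), Respects π C → #(arcs (leftGraph H π)) ≤ B) :
    coloringSkewness H C ≤ B := by
  classical
  unfold coloringSkewness
  exact Finset.sup_le fun π hπ => h π (by simpa using hπ)

theorem exists_coloringSkewness_eq [Fintype V] (H : Digraph V) :
    ∃ C : V → ℕ, coloringSkewness H C = skewness H :=
  Nat.sInf_mem (Set.range_nonempty fun C : V → ℕ => coloringSkewness H C)

theorem skewness_le [Fintype V] (H : Digraph V) (C : V → ℕ) :
    skewness H ≤ coloringSkewness H C :=
  Nat.sInf_le ⟨C, rfl⟩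

/-- An ordering and its reverse both respect an optimal coloring, and each arc is covered by one of
them. -/
theorem card_arcs_le_two_mul_skewness [Fintype V] {H : Digraph V} (hH : IsDag H) :
    #(arcs H) ≤ 2 * skewness H := by
  classical
  obtain ⟨C, hC⟩ := exists_coloringSkewness_eq H
  obtain ⟨π, hπ⟩ := exists_respects C
  have h1 := card_arcs_leftGraph_le H hπ
  have h2 := card_arcs_leftGraph_le H hπ.rev
  rw [arcs_leftGraph] at h1 h2
  have h3 := card_filter_add_card_filter_not (s := arcs H) (fun e : V × V => π e.1 < π e.2)
  have h4 : #{e ∈ arcs H | ¬ π e.1 < π e.2} ≤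
      #{e ∈ arcs H | (π.trans Fin.revPerm) e.1 < (π.trans Fin.revPerm) e.2} := by
    refine card_le_card fun e he => ?_
    rw [mem_filter] at he ⊢
    refine ⟨he.1, ?_⟩
    simp only [Equiv.trans_apply, Fin.revPerm_apply, Fin.rev_lt_rev]
    refine lt_of_le_of_ne (not_lt.1 he.2) fun h => ?_
    have := mem_arcs.1 he.1
    rw [π.injective h] at this
    exact hH.irrefl _ this
  omega

/-- A coloring none of whose respecting permutations covers every arc. -/
theorem skewness_lt_of_coloring [Fintype V] {H : Digraph V} (hm : 0 < #(arcs H)) (C : V → ℕ)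
    (h : ∀ π : V ≃ Fin (Fintype.card V), Respects π C → ∃ e ∈ arcs H, ¬ π e.1 < π e.2) :
    skewness H < #(arcs H) := by
  classical
  refine (skewness_le H C).trans_lt ?_
  have : coloringSkewness H C ≤ #(arcs H) - 1 := by
    refine coloringSkewness_le fun π hπ => ?_
    obtain ⟨e, he, hne⟩ := h π hπ
    have : #{e ∈ arcs H | π e.1 < π e.2} < #(arcs H) := by
      refine card_lt_card ((filter_subset _ _).ssubset_of_ne fun heq => ?_)
      rw [← heq] at he
      exact hne (mem_filter.1 he).2
    rw [arcs_leftGraph]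
    omega
  omega

/-- A dag in which any two arcs have a common tail or a common head is a rooted star. -/
theorem isRootedStar_of_forall {H : Digraph V} (hH : IsDag H) (hiso : NoIsolatedVertex H)
    (hdisj : ∀ a b c d, H.Adj a b → H.Adj c d → a = c ∨ b = d)
    (hne : ∃ a b, H.Adj a b) : IsRootedStar H := by
  obtain ⟨a, b, hab⟩ := hne
  by_cases h : ∀ c d, H.Adj c d → c = a
  · refine ⟨a, Or.inl fun u v => ⟨fun huv => ?_, ?_⟩⟩
    · obtain rfl := h u v huv
      exact ⟨rfl, fun e => hH.irrefl _ (e ▸ huv)⟩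
    · rintro ⟨rfl, hv⟩
      obtain ⟨w, hw | hw⟩ := hiso v
      · rwa [← h _ _ hw]
      · exact absurd (h _ _ hw) hv
  · push Not at h
    obtain ⟨c, d, hcd, hca⟩ := h
    have hbd : b = d := (hdisj a b c d hab hcd).resolve_left (Ne.symm hca)
    subst hbd
    have key : ∀ x y, H.Adj x y → y = b := by
      intro x y hxy
      rcases hdisj a b x y hab hxy with rfl | h1
      · exact ((hdisj c b a y hcd hxy).resolve_left hca).symm
      · exact h1.symm
    refine ⟨b, Or.inr fun u v => ⟨fun huv => ?_, ?_⟩⟩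
    · obtain rfl := key u v huv
      exact ⟨rfl, fun e => hH.irrefl _ (e ▸ huv)⟩
    · rintro ⟨rfl, hu⟩
      obtain ⟨w, hw | hw⟩ := hiso u
      · exact absurd (key _ _ hw) hu
      · rwa [← key _ _ hw]

theorem skewness_lt_card_arcs [Fintype V] {H : Digraph V} (hH : IsDag H)
    (hiso : NoIsolatedVertex H) (hm : 0 < #(arcs H)) (hstar : ¬ IsRootedStar H) :
    skewness H < #(arcs H) := by
  classical
  by_cases hpath : ∃ u v w, H.Adj u v ∧ H.Adj v w
  · obtain ⟨u, v, w, huv, hvw⟩ := hpath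
    -- The middle vertex of the path gets a color of its own; covering both arcs would put it
    -- strictly between two vertices of the other color.
    refine skewness_lt_of_coloring hm (fun x => if x = v then 1 else 0) fun π hπ => ?_
    by_contra! hcov
    have h1 := hcov (u, v) (mem_arcs.2 huv)
    have h2 := hcov (v, w) (mem_arcs.2 hvw)
    have hu : u ≠ v := fun e => by simp [e] at h1
    have hw : w ≠ v := fun e => by simp [e] at h2
    simpa [hu, hw] using hπ u v w h1 h2
  push Not at hpath
  by_cases hdisj : ∃ a b c d, H.Adj a b ∧ H.Adj c d ∧ a ≠ c ∧ b ≠ d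
  · obtain ⟨a, b, c, d, hab, hcd, hac, hbd⟩ := hdisj
    have had : a ≠ d := fun e => hpath c d b hcd (e ▸ hab)
    have hbc : b ≠ c := fun e => hpath a b d hab (e ▸ hcd)
    have hab' : a ≠ b := fun e => hH.irrefl b (e ▸ hab)
    have hcd' : c ≠ d := fun e => hH.irrefl d (e ▸ hcd)
    -- The tail of one arc shares a color with the head of the other. If both arcs are covered,
    -- whichever of b, d comes first lies between two vertices of the opposite color.
    refine skewness_lt_of_coloring hm (fun x => if x = a ∨ x = d then 1 else 0) fun π hπ => ?_
    by_contra! hcov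
    have h1 : π a < π b := hcov (a, b) (mem_arcs.2 hab)
    have h2 : π c < π d := hcov (c, d) (mem_arcs.2 hcd)
    rcases lt_or_ge (π b) (π d) with h | h
    · simpa [hab'.symm, hbd] using hπ a b d h1 h
    have h3 : π d < π b := lt_of_le_of_ne h fun e => hbd (π.injective e).symm
    simpa [hab'.symm, hbd, hcd', hac.symm] using hπ c d b h2 h3
  push Not at hdisj
  refine absurd (isRootedStar_of_forall hH hiso
    (fun a b c d h h' => or_iff_not_imp_left.2 (hdisj a b c d h h')) ?_) hstar
  obtain ⟨e, he⟩ := card_pos.1 hm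
  exact ⟨e.1, e.2, mem_arcs.1 he⟩

end

/-! ### Upper bound on skewness by balanced random colorings. -/

section

variable {V κ : Type*}

section Balanced

variable [DecidableEq κ]

/-- The number of arcs of `A` from the color class of `p.1` to that of `p.2`. -/
def colorCount (A : Finset (V × V)) (C : V → κ) (p : κ × κ) : ℝ :=
  ∑ e ∈ A, if (C e.1, C e.2) = p then 1 else 0

theorem colorCount_mono {A L : Finset (V × V)} (h : L ⊆ A) (C : V → κ) (p : κ × κ) :
    colorCount L C p ≤ colorCount A C p :=
  sum_le_sum_of_subset_of_nonneg h fun _ _ _ => by split_ifs <;> norm_num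

theorem colorCount_eq_zero {A : Finset (V × V)} {C : V → κ} {p : κ × κ}
    (h : ∀ e ∈ A, (C e.1, C e.2) ≠ p) : colorCount A C p = 0 :=
  sum_eq_zero fun e he => if_neg (h e he)

variable [Fintype κ]

theorem sum_colorCount (A : Finset (V × V)) (C : V → κ) : ∑ p, colorCount A C p = #A := by
  simp only [colorCount]
  rw [sum_comm]
  simp

theorem sum_colorCount_swap (A : Finset (V × V)) (C : V → κ) :
    ∑ p : κ × κ, colorCount A C p.swap = #A := by
  rw [← sum_colorCount A C]
  exact (Equiv.prodComm κ κ).sum_comp (colorCount A C)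

theorem sum_colorCount_diag (A : Finset (V × V)) (C : V → κ) :
    ∑ p : κ × κ, (if p.1 = p.2 then colorCount A C p else 0) =
      ∑ e ∈ A, if C e.1 = C e.2 then (1 : ℝ) else 0 := by
  simp only [colorCount]
  have : ∀ p : κ × κ, (if p.1 = p.2 then ∑ e ∈ A, (if (C e.1, C e.2) = p then (1 : ℝ) else 0)
      else 0) = ∑ e ∈ A, if (C e.1, C e.2) = p then (if C e.1 = C e.2 then (1 : ℝ) else 0) else 0 := by
    intro p
    split_ifs with hp
    · refine sum_congr rfl fun e _ => ?_
      by_cases h : (C e.1, C e.2) = p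
      · subst h; simp [show C e.1 = C e.2 from hp]
      · simp [h]
    · refine (sum_eq_zero fun e _ => ?_).symm
      by_cases h : (C e.1, C e.2) = p
      · subst h; simp [show ¬ C e.1 = C e.2 from hp]
      · simp [h]
  simp only [this]
  rw [sum_comm]
  simp

/-- If between any two color classes the arcs of `L ⊆ A` go in one direction only, then `L` has
about half the arcs of `A`, up to monochromatic arcs and the imbalances of `A`. -/
theorem card_le_of_oneWay {A L : Finset (V × V)} (hLA : L ⊆ A) (C : V → κ)
    (hL : ∀ e ∈ L, ∀ f ∈ L, C e.1 ≠ C e.2 → ¬ (C f.1 = C e.2 ∧ C f.2 = C e.1)) :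
    (#L : ℝ) ≤ #A / 2 + (∑ e ∈ A, if C e.1 = C e.2 then (1 : ℝ) else 0) / 2 +
      (∑ p : κ × κ, |colorCount A C p - colorCount A C p.swap|) / 4 := by
  -- For distinct colors one of the two directions is absent from L, and max(x, y) = (x + y + |x -
  -- y|)/2. On the diagonal all arcs are allowed, which costs the extra last term. Summing over
  -- ordered pairs counts every arc of L four times.
  have key : ∀ p : κ × κ, 2 * (colorCount L C p + colorCount L C p.swap) ≤
      colorCount A C p + colorCount A C p.swap + |colorCount A C p - colorCount A C p.swap| +
        2 * (if p.1 = p.2 then colorCount A C p else 0) := by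
    intro p
    have h1 := colorCount_mono hLA C p
    have h2 := colorCount_mono hLA C p.swap
    have h3 := le_abs_self (colorCount A C p - colorCount A C p.swap)
    have h4 := neg_le_abs (colorCount A C p - colorCount A C p.swap)
    split_ifs with hp
    · have : p.swap = p := Prod.ext hp.symm hp
      rw [this] at h2 ⊢
      rw [sub_self, abs_zero]
      linarith
    · have : colorCount L C p = 0 ∨ colorCount L C p.swap = 0 := by
        by_contra! hne
        have e1 : ∃ e ∈ L, (C e.1, C e.2) = p := by
          by_contra! h
          exact hne.1 (colorCount_eq_zero h)
        have e2 : ∃ e ∈ L, (C e.1, C e.2) = p.swap := by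
          by_contra! h
          exact hne.2 (colorCount_eq_zero h)
        obtain ⟨e, he, rfl⟩ := e1
        obtain ⟨f, hf, hfe⟩ := e2
        exact hL e he f hf hp (Prod.ext_iff.1 hfe)
      rcases this with h | h <;> rw [h] <;> linarith
  have := sum_le_sum fun p (_ : p ∈ (univ : Finset (κ × κ))) => key p
  simp only [sum_add_distrib, ← mul_sum, sum_colorCount, sum_colorCount_swap,
    sum_colorCount_diag] at this
  linarith

theorem sum_ite_sub_ite_mul (a b : κ × κ) :
    ∑ p : κ × κ, (((if a = p then (1 : ℝ) else 0) - if a = p.swap then 1 else 0) *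
        ((if b = p then (1 : ℝ) else 0) - if b = p.swap then 1 else 0)) =
      2 * ((if a = b then (1 : ℝ) else 0) - if a = b.swap then 1 else 0) := by
  have hs : ∀ x p : κ × κ, x = p.swap ↔ x.swap = p := fun x p =>
    ⟨fun h => by rw [h, Prod.swap_swap], fun h => by rw [← h, Prod.swap_swap]⟩
  simp only [hs, mul_sub, sum_sub_distrib, mul_ite, mul_one, mul_zero, sum_ite_eq, mem_univ,
    if_true]
  rw [Prod.swap_swap]
  split_ifs <;> norm_num

/-- Each arc contributes +1 or -1 to the imbalance at its own color pair and at the swapped one;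
expanding the square gives a sum over pairs of arcs that can be averaged termwise. -/
theorem sum_sq_imbalance (A : Finset (V × V)) (C : V → κ) :
    ∑ p : κ × κ, (colorCount A C p - colorCount A C p.swap) ^ 2 =
      ∑ e ∈ A, ∑ f ∈ A, 2 * ((if (C e.1, C e.2) = (C f.1, C f.2) then (1 : ℝ) else 0) -
        if (C e.1, C e.2) = (C f.2, C f.1) then 1 else 0) := by
  simp only [colorCount, ← sum_sub_distrib, sq, sum_mul_sum]
  rw [sum_comm]
  refine sum_congr rfl fun e _ => ?_
  rw [sum_comm]
  exact sum_congr rfl fun f _ => sum_ite_sub_ite_mul _ _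

end Balanced

section Average

variable [Fintype V] [DecidableEq V] {k : ℕ}

/-- Recoloring u arbitrarily is injective on such colorings, as the old color of u can be read off
from v. -/
theorem mul_card_coloring_eq_le {u v : V} (huv : u ≠ v) :
    k * #{C : V → Fin k | C u = C v} ≤ k ^ Fintype.card V := by
  have : #(({C : V → Fin k | C u = C v} : Finset _) ×ˢ (univ : Finset (Fin k))) ≤
      #(univ : Finset (V → Fin k)) := by
    refine card_le_card_of_injOn (fun x => Function.update x.1 u x.2) (by simp) ?_
    rintro ⟨C, s⟩ hC ⟨D, t⟩ hD h
    simp only [coe_product, Set.mem_prod, mem_coe, mem_filter, mem_univ, true_and, and_true]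
      at hC hD h
    have hst : s = t := by simpa using congrFun h u
    have hne : ∀ w, w ≠ u → C w = D w := fun w hw => by simpa [hw] using congrFun h w
    refine Prod.ext (funext fun w => ?_) hst
    by_cases hw : w = u
    · subst hw
      show C w = D w
      rw [hC, hD, hne v huv.symm]
    · exact hne w hw
  simpa [mul_comm] using this

theorem sum_coloring_eq_le {u v : V} (huv : u ≠ v) (hk : 0 < k) :
    ∑ C : V → Fin k, (if C u = C v then (1 : ℝ) else 0) ≤ (k : ℝ) ^ Fintype.card V / k := by
  rw [sum_boole, le_div_iff₀ (by exact_mod_cast hk), mul_comm]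
  exact_mod_cast mul_card_coloring_eq_le huv

/-- Disjoint arcs do not contribute to the expected squared imbalance. -/
theorem sum_coloring_disjoint {e f : V × V} (h11 : e.1 ≠ f.1) (h12 : e.1 ≠ f.2) (h21 : e.2 ≠ f.1)
    (h22 : e.2 ≠ f.2) :
    ∑ C : V → Fin k, ((if (C e.1, C e.2) = (C f.1, C f.2) then (1 : ℝ) else 0) -
      if (C e.1, C e.2) = (C f.2, C f.1) then 1 else 0) = 0 := by
  rw [sum_sub_distrib, sub_eq_zero]
  -- Exchanging the colors of the two ends of f permutes the colorings, fixes the colors on e, and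
  -- interchanges the two indicators.
  refine Fintype.sum_equiv (Equiv.arrowCongr (Equiv.swap f.1 f.2) (Equiv.refl _)) _ _ fun C => ?_
  have hswap : ∀ v, (Equiv.arrowCongr (Equiv.swap f.1 f.2) (Equiv.refl (Fin k))) C v =
      C (Equiv.swap f.1 f.2 v) := fun v => by simp [Equiv.arrowCongr]
  rw [hswap, hswap, hswap, hswap, Equiv.swap_apply_of_ne_of_ne h11 h12,
    Equiv.swap_apply_of_ne_of_ne h21 h22, Equiv.swap_apply_left, Equiv.swap_apply_right]

theorem ite_sub_ite_le {P Q R : Prop} [Decidable P] [Decidable Q] [Decidable R] (h : P → Q) :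
    ((if P then (1 : ℝ) else 0) - if R then 1 else 0) ≤ if Q then 1 else 0 := by
  by_cases hP : P <;> by_cases hQ : Q <;> by_cases hR : R <;> simp_all

/-- Distinct arcs differ in their tails or their heads, so agreement of color pairs forces two
distinct vertices to share a color; the subtracted term is simply dropped. -/
theorem sum_coloring_le {e f : V × V} (hef : e ≠ f) (hk : 0 < k) :
    ∑ C : V → Fin k, ((if (C e.1, C e.2) = (C f.1, C f.2) then (1 : ℝ) else 0) -
      if (C e.1, C e.2) = (C f.2, C f.1) then 1 else 0) ≤ (k : ℝ) ^ Fintype.card V / k := by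
  by_cases h1 : e.1 = f.1
  · have h2 : e.2 ≠ f.2 := fun h => hef (Prod.ext h1 h)
    refine le_trans (sum_le_sum fun C _ => ?_) (sum_coloring_eq_le h2 hk)
    exact ite_sub_ite_le fun h => (Prod.ext_iff.1 h).2
  · refine le_trans (sum_le_sum fun C _ => ?_) (sum_coloring_eq_le h1 hk)
    exact ite_sub_ite_le fun h => (Prod.ext_iff.1 h).1

theorem card_touching_le (A : Finset (V × V)) (e : V × V) :
    #{f ∈ A | e.1 = f.1 ∨ e.1 = f.2 ∨ e.2 = f.1 ∨ e.2 = f.2} ≤ 4 * Fintype.card V := by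
  have h : ({f ∈ A | e.1 = f.1 ∨ e.1 = f.2 ∨ e.2 = f.1 ∨ e.2 = f.2} : Finset (V × V)) ⊆
      (({e.1} ×ˢ univ) ∪ (univ ×ˢ {e.1})) ∪ (({e.2} ×ˢ univ) ∪ (univ ×ˢ {e.2})) := by
    intro f hf
    simp only [mem_filter] at hf
    simp only [mem_union, mem_product, mem_singleton, mem_univ, and_true, true_and]
    tauto
  refine (card_le_card h).trans ((card_union_le _ _).trans ?_)
  have h1 := card_union_le ({e.1} ×ˢ univ : Finset (V × V)) (univ ×ˢ {e.1})
  have h2 := card_union_le ({e.2} ×ˢ univ : Finset (V × V)) (univ ×ˢ {e.2})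
  simp only [card_product, card_singleton, card_univ] at h1 h2
  omega

/-- In each row the diagonal pair costs at most 1, the at most 4h touching pairs cost at most 1/k
each, and disjoint pairs cost 0, all relative to the number of colorings. -/
theorem sum_coloring_sq_imbalance_le (A : Finset (V × V)) (hk : 0 < k) :
    ∑ C : V → Fin k, ∑ p : Fin k × Fin k, (colorCount A C p - colorCount A C p.swap) ^ 2 ≤
      (k : ℝ) ^ Fintype.card V * (2 * (#A + 4 * #A * Fintype.card V / k)) := by
  have hpos : (0 : ℝ) ≤ (k : ℝ) ^ Fintype.card V / k := by positivity
  simp only [sum_sq_imbalance, ← mul_sum]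
  rw [sum_comm]
  have hrow : ∀ e ∈ A, ∑ C : V → Fin k, ∑ f ∈ A,
      ((if (C e.1, C e.2) = (C f.1, C f.2) then (1 : ℝ) else 0) -
        if (C e.1, C e.2) = (C f.2, C f.1) then 1 else 0) ≤
      (k : ℝ) ^ Fintype.card V + 4 * Fintype.card V * ((k : ℝ) ^ Fintype.card V / k) := by
    intro e he
    rw [sum_comm]
    have hf : ∀ f ∈ A, ∑ C : V → Fin k,
        ((if (C e.1, C e.2) = (C f.1, C f.2) then (1 : ℝ) else 0) -
          if (C e.1, C e.2) = (C f.2, C f.1) then 1 else 0) ≤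
        (if f = e then (k : ℝ) ^ Fintype.card V else 0) +
          if e.1 = f.1 ∨ e.1 = f.2 ∨ e.2 = f.1 ∨ e.2 = f.2 then (k : ℝ) ^ Fintype.card V / k
          else 0 := by
      intro f _
      by_cases hfe : f = e
      · subst hfe
        have : ∑ C : V → Fin k, ((if (C f.1, C f.2) = (C f.1, C f.2) then (1 : ℝ) else 0) -
          if (C f.1, C f.2) = (C f.2, C f.1) then 1 else 0) ≤ ∑ C : V → Fin k, (1 : ℝ) := by
          refine sum_le_sum fun C _ => ?_
          split_ifs <;> norm_num
        simp only [sum_const, card_univ, Fintype.card_fun, Fintype.card_fin, nsmul_eq_mul,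
          mul_one, Nat.cast_pow] at this
        rw [if_pos rfl, if_pos (Or.inl rfl)]
        linarith
      · by_cases h : e.1 = f.1 ∨ e.1 = f.2 ∨ e.2 = f.1 ∨ e.2 = f.2
        · rw [if_pos h, if_neg hfe, zero_add]
          exact sum_coloring_le (Ne.symm hfe) hk
        · rw [if_neg h, if_neg hfe, zero_add]
          push Not at h
          exact (sum_coloring_disjoint h.1 h.2.1 h.2.2.1 h.2.2.2).le
    refine (sum_le_sum hf).trans ?_
    rw [sum_add_distrib, sum_ite_eq' A e, if_pos he, ← sum_filter, sum_const, nsmul_eq_mul]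
    have : ((#{f ∈ A | e.1 = f.1 ∨ e.1 = f.2 ∨ e.2 = f.1 ∨ e.2 = f.2} : ℕ) : ℝ) ≤
        4 * Fintype.card V := by exact_mod_cast card_touching_le A e
    gcongr
  refine (mul_le_mul_of_nonneg_left (sum_le_sum hrow) (by norm_num)).trans (le_of_eq ?_)
  rw [sum_const, nsmul_eq_mul]
  ring

theorem sum_coloring_mono_le {A : Finset (V × V)} (hA : ∀ e ∈ A, e.1 ≠ e.2) (hk : 0 < k) :
    ∑ C : V → Fin k, ∑ e ∈ A, (if C e.1 = C e.2 then (1 : ℝ) else 0) ≤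
      (k : ℝ) ^ Fintype.card V * (#A / k) := by
  rw [sum_comm]
  refine (sum_le_sum fun e he => sum_coloring_eq_le (hA e he) hk).trans (le_of_eq ?_)
  rw [sum_const, nsmul_eq_mul]
  ring

/-- Some coloring with `k` colors is balanced. -/
theorem exists_balanced_coloring {A : Finset (V × V)} (hA : ∀ e ∈ A, e.1 ≠ e.2) (hk : 0 < k)
    {t : ℝ} (ht : 0 < t) :
    ∃ C : V → Fin k, ∀ L ⊆ A,
      (∀ e ∈ L, ∀ f ∈ L, C e.1 ≠ C e.2 → ¬ (C f.1 = C e.2 ∧ C f.2 = C e.1)) →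
      (#L : ℝ) ≤ #A / 2 + #A / k / 2 + k ^ 2 * t / 8 +
        (#A + 4 * #A * Fintype.card V / k) / (4 * t) := by
  have hne : (univ : Finset (V → Fin k)).Nonempty := ⟨fun _ => ⟨0, hk⟩, mem_univ _⟩
  have h1 := sum_coloring_mono_le hA hk
  have h2 := sum_coloring_sq_imbalance_le A hk
  -- One coloring must control both errors, so a weighted sum is averaged. The weight 1/(4t) makes
  -- it exactly twice the combined error left in `card_le_of_oneWay` after replacing |y| by y²/(2t)
  -- + t/2.
  have hle : ∑ C : V → Fin k, ((∑ e ∈ A, (if C e.1 = C e.2 then (1 : ℝ) else 0)) +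
      (∑ p : Fin k × Fin k, (colorCount A C p - colorCount A C p.swap) ^ 2) / (4 * t)) ≤
      ∑ C : V → Fin k, (#A / k + (2 * (#A + 4 * #A * Fintype.card V / k)) / (4 * t) : ℝ) := by
    rw [sum_add_distrib, ← sum_div, sum_const, card_univ, Fintype.card_fun, Fintype.card_fin,
      nsmul_eq_mul, Nat.cast_pow, mul_add]
    refine add_le_add h1 ?_
    rw [← mul_div_assoc]
    gcongr
  obtain ⟨C, -, hC⟩ := exists_le_of_sum_le hne hle
  refine ⟨C, fun L hLA hL => (card_le_of_oneWay hLA C hL).trans ?_⟩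
  have h3 : ∑ p : Fin k × Fin k, |colorCount A C p - colorCount A C p.swap| ≤
      ∑ p : Fin k × Fin k, ((colorCount A C p - colorCount A C p.swap) ^ 2 / (2 * t) + t / 2) := by
    refine sum_le_sum fun p _ => ?_
    rw [← sq_abs]
    have := sq_nonneg (|colorCount A C p - colorCount A C p.swap| - t)
    rw [← sub_nonneg]
    have e : |colorCount A C p - colorCount A C p.swap| ^ 2 / (2 * t) + t / 2 -
      |colorCount A C p - colorCount A C p.swap| =
      (|colorCount A C p - colorCount A C p.swap| - t) ^ 2 / (2 * t) := by
      field_simp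
      ring
    rw [e]
    positivity
  rw [sum_add_distrib, ← sum_div, sum_const, card_univ, Fintype.card_prod, Fintype.card_fin,
    nsmul_eq_mul, Nat.cast_mul] at h3
  have e1 : ∀ x : ℝ, x / (4 * t) = x / (2 * t) / 2 := fun x => by field_simp; norm_num
  have e2 : (2 * (#A + 4 * #A * Fintype.card V / k)) / (4 * t) =
    2 * ((#A + 4 * #A * Fintype.card V / k) / (4 * t)) := by ring
  rw [e2, e1 (∑ p : Fin k × Fin k, _)] at hC
  nlinarith [h3, hC]

end Average

/-- Consecutive classes make the covered arcs one-way between any two classes: two covered arcs in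
opposite directions would interleave the classes. The floor converts the real bound to one on the
natural-number supremum. -/
theorem skewness_le_of_colors [Fintype V] {H : Digraph V} (hH : IsDag H) {k : ℕ} (hk : 0 < k)
    {t : ℝ} (ht : 0 < t) :
    (skewness H : ℝ) ≤ #(arcs H) / 2 + #(arcs H) / k / 2 + k ^ 2 * t / 8 +
        (#(arcs H) + 4 * #(arcs H) * Fintype.card V / k) / (4 * t) := by
  classical
  obtain ⟨C, hC⟩ := exists_balanced_coloring (A := arcs H) (k := k)
    (fun e he h => hH.irrefl e.1 (by have := mem_arcs.1 he; rwa [← h] at this)) hk ht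
  have hsk : skewness H ≤ ⌊(#(arcs H) / 2 + #(arcs H) / k / 2 + k ^ 2 * t / 8 +
        (#(arcs H) + 4 * #(arcs H) * Fintype.card V / k) / (4 * t) : ℝ)⌋₊ := by
    refine (skewness_le H fun v => (C v : ℕ)).trans (coloringSkewness_le fun π hπ => ?_)
    rw [arcs_leftGraph]
    refine Nat.le_floor (hC _ (filter_subset _ _) fun e he f hf hne hfe => ?_)
    have he' := (mem_filter.1 he).2
    have hf' := (mem_filter.1 hf).2
    have hR : ∀ u v w, π u < π v → π v < π w → C u = C w → C v = C u := fun u v w h1 h2 h3 =>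
      Fin.ext (hπ u v w h1 h2 (congrArg Fin.val h3))
    rcases lt_or_ge (π e.2) (π f.2) with h | h
    · exact hne (hR _ _ _ he' h hfe.2.symm).symm
    rcases h.lt_or_eq with h | h
    · exact hne (by rw [← hfe.1, ← hfe.2]; exact hR _ _ _ hf' h hfe.1)
    · exact hne (by rw [← hfe.2, π.injective h])
  exact (Nat.cast_le.2 hsk).trans (Nat.floor_le (by positivity))

theorem card_le_two_mul_card_arcs [Fintype V] {H : Digraph V} (hiso : NoIsolatedVertex H) :
    Fintype.card V ≤ 2 * #(arcs H) := by
  classical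
  have : (univ : Finset V) ⊆ (arcs H).image Prod.fst ∪ (arcs H).image Prod.snd := by
    intro v _
    obtain ⟨u, h | h⟩ := hiso v
    · exact mem_union_right _ (mem_image.2 ⟨(u, v), mem_arcs.2 h, rfl⟩)
    · exact mem_union_left _ (mem_image.2 ⟨(v, u), mem_arcs.2 h, rfl⟩)
  have h1 := (card_le_card this).trans (card_union_le _ _)
  have h2 := card_image_le (s := arcs H) (f := Prod.fst)
  have h3 := card_image_le (s := arcs H) (f := Prod.snd)
  rw [card_univ] at h1
  omega

theorem skewness_sub_half_le [Fintype V] {H : Digraph V} (hH : IsDag H)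
    (hiso : NoIsolatedVertex H) (hm : 0 < #(arcs H)) :
    |(skewness H : ℝ) - (#(arcs H) : ℝ) / 2| ≤
      7 * (#(arcs H) : ℝ) ^ (4 / 5 : ℝ) * (Fintype.card V : ℝ) ^ (1 / 5 : ℝ) := by
  obtain ⟨e, -⟩ := card_pos.1 hm
  have hh : 1 ≤ Fintype.card V := Fintype.card_pos_iff.2 ⟨e.1⟩
  have hhm := card_le_two_mul_card_arcs hiso
  have hmh : #(arcs H) ≤ Fintype.card V * Fintype.card V := by
    simpa using card_le_univ (arcs H)
  have hlow := card_arcs_le_two_mul_skewness hH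
  have hup := fun k hk t ht => skewness_le_of_colors (V := V) hH (k := k) hk (t := t) ht
  generalize hs : (skewness H) = s at *
  generalize #(arcs H) = m at *
  generalize Fintype.card V = h at *
  have hm' : (0 : ℝ) < m := by exact_mod_cast hm
  have hh' : (1 : ℝ) ≤ h := by exact_mod_cast hh
  have hhm' : (h : ℝ) ≤ 2 * m := by exact_mod_cast hhm
  have hmh' : (m : ℝ) ≤ h * h := by exact_mod_cast hmh
  have hlow' : (m : ℝ) ≤ 2 * s := by exact_mod_cast hlow
  -- With x⁵ = m/h the target error is x⁴h. The bounds 1/2 ≤ x ≤ h, from h ≤ 2m and m ≤ h², absorb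
  -- the rounding and the lower-order terms.
  set x : ℝ := ((m : ℝ) / h) ^ (1 / 5 : ℝ) with hx
  have hx0 : 0 < x := by positivity
  have hx5 : x ^ 5 = m / h := by
    rw [hx, ← Real.rpow_natCast, ← Real.rpow_mul (by positivity)]
    norm_num
  have hmx : (m : ℝ) = x ^ 5 * h := by rw [hx5]; field_simp
  have hxhalf : 1 / 2 ≤ x := by
    by_contra! hlt
    have : x ^ 5 < (1 / 2) ^ 5 := by gcongr
    rw [hx5, div_lt_iff₀ (by linarith)] at this
    linarith
  have hxh : x ≤ h := by
    by_contra! hlt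
    have : (h : ℝ) ^ 5 < x ^ 5 := by gcongr
    rw [hx5, lt_div_iff₀ (by linarith)] at this
    have h2 : (h : ℝ) * h ≤ h ^ 5 * h := by
      have := one_le_pow₀ (n := 4) hh'
      nlinarith [mul_le_mul_of_nonneg_left this (by positivity : (0 : ℝ) ≤ h * h)]
    linarith
  have htarget : (m : ℝ) ^ (4 / 5 : ℝ) * (h : ℝ) ^ (1 / 5 : ℝ) = x ^ 4 * h := by
    have e1 : (x ^ 5) ^ (4 / 5 : ℝ) = x ^ 4 := by
      rw [← Real.rpow_natCast x 5, ← Real.rpow_mul hx0.le, ← Real.rpow_natCast x 4]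
      norm_num
    rw [hmx, Real.mul_rpow (by positivity) (by positivity), e1, mul_assoc,
      ← Real.rpow_add (by linarith)]
    norm_num
  rw [mul_assoc, htarget]
  have hK : (0 : ℝ) ≤ x ^ 4 * h := by positivity
  rw [abs_le]
  refine ⟨by linarith, ?_⟩
  have hk0 : 0 < ⌈x⌉₊ := Nat.ceil_pos.2 hx0
  -- Take k = ⌈x⌉ and t = h. The three errors are at most 1/2, 36/8 and 7/4 times x⁴h, in total 27/4
  -- < 7.
  have hB := hup ⌈x⌉₊ hk0 h (by linarith)
  have hk1 : x ≤ (⌈x⌉₊ : ℝ) := Nat.le_ceil x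
  have hk2 : (⌈x⌉₊ : ℝ) ≤ 3 * x := by
    have := Nat.ceil_lt_add_one hx0.le
    linarith
  generalize (⌈x⌉₊ : ℝ) = k at *
  have hk : 0 < k := by linarith
  have b1 : (m : ℝ) / k ≤ x ^ 4 * h := by
    rw [div_le_iff₀ hk, hmx]
    nlinarith [mul_le_mul_of_nonneg_left hk1 hK]
  have b2 : k ^ 2 * h ≤ 36 * (x ^ 4 * h) := by
    have q1 : k ^ 2 ≤ (3 * x) ^ 2 := by gcongr
    have q2 : (9 : ℝ) * x ^ 2 ≤ 36 * x ^ 4 := by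
      have : (1 / 2) ^ 2 ≤ x ^ 2 := by gcongr
      nlinarith [mul_le_mul_of_nonneg_left this (sq_nonneg x)]
    have : k ^ 2 ≤ 36 * x ^ 4 := by linarith
    nlinarith
  have b3 : ((m : ℝ) + 4 * m * h / k) / (4 * h) ≤ 7 / 4 * (x ^ 4 * h) := by
    have q : (m : ℝ) ≤ 3 * (m * h / k) := by
      rw [← mul_div_assoc, le_div_iff₀ hk]
      nlinarith
    have e : ((m : ℝ) + 4 * m * h / k) = m + 4 * (m * h / k) := by ring
    rw [e]
    have q2 : m * h / k = (m / k) * h := by ring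
    rw [div_le_iff₀ (by linarith)]
    nlinarith
  linarith

end

/-! ### Product measures, Harris' inequality and Janson's inequality. -/

section

section Bernoulli

variable {α : Type*} [Fintype α] [DecidableEq α]

/-- The probability of the outcome `E` when each `e` is picked independently with
probability `p e`. -/
def bernWeight (p : α → ℝ) (E : Finset α) : ℝ :=
  ∏ e, if e ∈ E then p e else 1 - p e

/-- Expectation with respect to `bernWeight`. -/
def bernExp (p : α → ℝ) (f : Finset α → ℝ) : ℝ :=
  ∑ E, bernWeight p E * f E

theorem bernWeight_nonneg {p : α → ℝ} (h0 : ∀ e, 0 ≤ p e) (h1 : ∀ e, p e ≤ 1) (E : Finset α) :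
    0 ≤ bernWeight p E :=
  prod_nonneg fun e _ => by split_ifs <;> linarith [h0 e, h1 e]

theorem bernExp_one (p : α → ℝ) : bernExp p (fun _ => 1) = 1 := by
  have h := prod_add p (fun e => 1 - p e) univ
  simp only [add_sub_cancel, prod_const_one, powerset_univ] at h
  refine Eq.trans ?_ h.symm
  simp only [bernExp, bernWeight, mul_one]
  refine sum_congr rfl fun E _ => ?_
  rw [prod_ite]
  congr 1
  · exact prod_congr (by ext; simp) fun _ _ => rfl
  · exact prod_congr (by ext; simp) fun _ _ => rfl

theorem bernExp_mono {p : α → ℝ} (h0 : ∀ e, 0 ≤ p e) (h1 : ∀ e, p e ≤ 1) {f g : Finset α → ℝ}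
    (h : ∀ E, f E ≤ g E) : bernExp p f ≤ bernExp p g :=
  sum_le_sum fun E _ => mul_le_mul_of_nonneg_left (h E) (bernWeight_nonneg h0 h1 E)

theorem bernExp_nonneg {p : α → ℝ} (h0 : ∀ e, 0 ≤ p e) (h1 : ∀ e, p e ≤ 1) {f : Finset α → ℝ}
    (h : ∀ E, 0 ≤ f E) : 0 ≤ bernExp p f :=
  sum_nonneg fun E _ => mul_nonneg (bernWeight_nonneg h0 h1 E) (h E)

theorem bernExp_sub (p : α → ℝ) (f g : Finset α → ℝ) :
    bernExp p (fun E => f E - g E) = bernExp p f - bernExp p g := by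
  simp only [bernExp, mul_sub, sum_sub_distrib]

theorem bernExp_sum (p : α → ℝ) {ι : Type*} (s : Finset ι) (f : ι → Finset α → ℝ) :
    bernExp p (fun E => ∑ i ∈ s, f i E) = ∑ i ∈ s, bernExp p (f i) := by
  simp only [bernExp, mul_sum]
  exact sum_comm

theorem bernExp_const_mul (p : α → ℝ) (c : ℝ) (f : Finset α → ℝ) :
    bernExp p (fun E => c * f E) = c * bernExp p f := by
  simp only [bernExp, mul_sum]
  exact sum_congr rfl fun E _ => by ring

theorem bernWeight_of_notMem (p : α → ℝ) {x : α} {E : Finset α} (hx : x ∉ E) :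
    bernWeight p E = (1 - p x) * ∏ e ∈ univ.erase x, if e ∈ E then p e else 1 - p e := by
  rw [bernWeight, ← mul_prod_erase univ _ (mem_univ x), if_neg hx]

theorem bernWeight_insert (p : α → ℝ) (x : α) (E : Finset α) :
    bernWeight p (insert x E) = p x * ∏ e ∈ univ.erase x, if e ∈ E then p e else 1 - p e := by
  rw [bernWeight, ← mul_prod_erase univ _ (mem_univ x), if_pos (mem_insert_self x E)]
  congr 1
  refine prod_congr rfl fun e he => ?_
  simp [ne_of_mem_erase he]

theorem bernExp_mem_mul (p : α → ℝ) {x : α} {g : Finset α → ℝ}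
    (hg : ∀ E, g (insert x E) = g E) :
    bernExp p (fun E => (if x ∈ E then 1 else 0) * g E) = p x * bernExp p g := by
  have split : ∀ f : Finset α → ℝ, bernExp p f =
      ∑ E ∈ (univ.erase x).powerset, (bernWeight p E * f E +
        bernWeight p (insert x E) * f (insert x E)) := by
    intro f
    rw [bernExp, ← powerset_univ, ← insert_erase (mem_univ x),
      sum_powerset_insert (notMem_erase x univ), sum_add_distrib]
    simp
  rw [split, split, mul_sum]
  refine sum_congr rfl fun E hE => ?_
  have hx : x ∉ E := fun h => notMem_erase x univ (mem_powerset.1 hE h)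
  rw [bernWeight_of_notMem p hx, bernWeight_insert, hg, if_neg hx,
    if_pos (mem_insert_self x E)]
  ring

/-- Independence: g does not depend on the coordinates in F. -/
theorem bernExp_subset_mul (p : α → ℝ) (F : Finset α) {g : Finset α → ℝ}
    (hg : ∀ x ∈ F, ∀ E, g (insert x E) = g E) :
    bernExp p (fun E => (if F ⊆ E then 1 else 0) * g E) = (∏ e ∈ F, p e) * bernExp p g := by
  induction F using Finset.induction_on with
  | empty => simp
  | insert x F hx ih =>
    have e : (fun E : Finset α => (if insert x F ⊆ E then (1 : ℝ) else 0) * g E) =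
        fun E => (if x ∈ E then 1 else 0) * ((if F ⊆ E then 1 else 0) * g E) := by
      funext E
      by_cases h1 : x ∈ E <;> by_cases h2 : F ⊆ E <;> simp [insert_subset_iff, h1, h2]
    rw [e, bernExp_mem_mul, ih fun y hy => hg y (mem_insert_of_mem hy), prod_insert hx, mul_assoc]
    intro E
    simp only [hg x (mem_insert_self x F), subset_insert_iff_of_notMem hx]

theorem bernExp_subset (p : α → ℝ) (F : Finset α) :
    bernExp p (fun E => if F ⊆ E then 1 else 0) = ∏ e ∈ F, p e := by
  have := bernExp_subset_mul p F (g := fun _ => 1) (fun _ _ _ => rfl)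
  simpa only [mul_one, bernExp_one] using this

/-- Harris' inequality for an increasing and a decreasing function. -/
theorem bernExp_mul_le {p : α → ℝ} (h0 : ∀ e, 0 ≤ p e) (h1 : ∀ e, p e ≤ 1)
    {f g : Finset α → ℝ} (hf0 : ∀ E, 0 ≤ f E) (hf : Monotone f) (hg1 : ∀ E, g E ≤ 1)
    (hg : Antitone g) :
    bernExp p (fun E => f E * g E) ≤ bernExp p f * bernExp p g := by
  -- The decreasing g enters as the increasing nonnegative 1 - g; a product weight satisfies the
  -- lattice condition with equality.
  have h := fkg f (fun E => 1 - g E) (bernWeight p) (bernWeight_nonneg h0 h1) hf0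
    (fun E => sub_nonneg.2 (hg1 E)) hf (fun _ _ h => sub_le_sub_left (hg h) 1) (by
      intro E F
      simp only [bernWeight, ← prod_mul_distrib]
      refine le_of_eq (prod_congr rfl fun e _ => ?_)
      by_cases hE : e ∈ E <;> by_cases hF : e ∈ F <;> simp [hE, hF, mul_comm])
  change bernExp p f * bernExp p (fun E => 1 - g E) ≤
    (∑ E, bernWeight p E) * bernExp p (fun E => f E * (1 - g E)) at h
  have hone : ∑ E, bernWeight p E = 1 := by simpa [bernExp] using bernExp_one p
  have e : (fun E => f E * (1 - g E)) = fun E => f E - f E * g E := by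
    funext E
    ring
  rw [hone, e, bernExp_sub, bernExp_sub, bernExp_one] at h
  linarith

theorem exists_bernExp_le {p : α → ℝ} (h0 : ∀ e, 0 ≤ p e) (h1 : ∀ e, p e ≤ 1)
    (f : Finset α → ℝ) : ∃ E, bernExp p f ≤ f E := by
  obtain ⟨E, hE⟩ := Finite.exists_max f
  refine ⟨E, (bernExp_mono h0 h1 hE).trans (le_of_eq ?_)⟩
  have := bernExp_const_mul p (f E) (fun _ => 1)
  simpa only [mul_one, bernExp_one] using this

end Bernoulli

section Janson

variable {α ι : Type*} [DecidableEq α]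

/-- The indicator of the event that none of the sets `F i`, `i ∈ S`, is contained in `E`. -/
def avoidInd (F : ι → Finset α) (S : Finset ι) (E : Finset α) : ℝ :=
  if ∀ i ∈ S, ¬ F i ⊆ E then 1 else 0

theorem avoidInd_nonneg (F : ι → Finset α) (S : Finset ι) (E : Finset α) :
    0 ≤ avoidInd F S E := by
  unfold avoidInd; split_ifs <;> norm_num

theorem avoidInd_le_one (F : ι → Finset α) (S : Finset ι) (E : Finset α) :
    avoidInd F S E ≤ 1 := by
  unfold avoidInd; split_ifs <;> norm_num

theorem avoidInd_antitone (F : ι → Finset α) (S : Finset ι) : Antitone (avoidInd F S) := by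
  intro E E' h
  unfold avoidInd
  split_ifs with h1 h2
  · exact le_rfl
  · exact absurd (fun i hi hs => h1 i hi (hs.trans h)) h2
  · norm_num
  · exact le_rfl

theorem avoidInd_anti_index (F : ι → Finset α) {S T : Finset ι} (h : S ⊆ T) (E : Finset α) :
    avoidInd F T E ≤ avoidInd F S E := by
  unfold avoidInd
  split_ifs with h1 h2
  · exact le_rfl
  · exact absurd (fun i hi => h1 i (h hi)) h2
  · norm_num
  · exact le_rfl

theorem avoidInd_insert [DecidableEq ι] (F : ι → Finset α) (i : ι) (S : Finset ι) (E : Finset α) :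
    avoidInd F (insert i S) E = avoidInd F S E - (if F i ⊆ E then 1 else 0) * avoidInd F S E := by
  unfold avoidInd
  by_cases h1 : F i ⊆ E <;> by_cases h2 : ∀ j ∈ S, ¬ F j ⊆ E <;> simp [h1, h2]

variable [Fintype α]

/-- Split S into indices whose sets are disjoint from F i and indices whose sets meet it. Avoiding
the former is independent of F i ⊆ E; the latter are removed by a union bound, where Harris'
inequality separates the increasing event F i ∪ F j ⊆ E from the decreasing avoidance event. -/
theorem bernExp_subset_mul_avoidInd_ge {p : α → ℝ} (h0 : ∀ e, 0 ≤ p e) (h1 : ∀ e, p e ≤ 1)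
    (F : ι → Finset α) (i : ι) (S : Finset ι) :
    (∏ e ∈ F i, p e - ∑ j ∈ S with ¬ Disjoint (F i) (F j), ∏ e ∈ F i ∪ F j, p e) *
        bernExp p (avoidInd F {j ∈ S | Disjoint (F i) (F j)}) ≤
      bernExp p (fun E => (if F i ⊆ E then 1 else 0) * avoidInd F S E) := by
  set I := {j ∈ S | Disjoint (F i) (F j)} with hI
  set D := {j ∈ S | ¬ Disjoint (F i) (F j)} with hD
  have hpt : ∀ E, (if F i ⊆ E then 1 else 0) * avoidInd F I E -
      ∑ j ∈ D, (if F i ∪ F j ⊆ E then 1 else 0) * avoidInd F I E ≤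
      (if F i ⊆ E then 1 else 0) * avoidInd F S E := by
    intro E
    have hnn : ∀ j ∈ D, 0 ≤ (if F i ∪ F j ⊆ E then (1 : ℝ) else 0) * avoidInd F I E := fun j _ =>
      mul_nonneg (by split_ifs <;> norm_num) (avoidInd_nonneg _ _ _)
    by_cases hi : F i ⊆ E
    · by_cases hS : ∀ j ∈ S, ¬ F j ⊆ E
      · have e1 : avoidInd F S E = 1 := if_pos hS
        have := avoidInd_le_one F I E
        have := sum_nonneg hnn
        rw [if_pos hi, e1]
        linarith
      · push Not at hS
        obtain ⟨j, hj, hjE⟩ := hS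
        rw [if_pos hi, one_mul, one_mul]
        refine le_trans ?_ (avoidInd_nonneg F S E)
        by_cases hd : Disjoint (F i) (F j)
        · have e1 : avoidInd F I E = 0 := if_neg fun h => h j (mem_filter.2 ⟨hj, hd⟩) hjE
          simp [e1]
        · have := single_le_sum hnn (show j ∈ D from mem_filter.2 ⟨hj, hd⟩)
          rw [if_pos (union_subset hi hjE), one_mul] at this
          linarith
    · rw [if_neg hi, zero_mul, zero_mul, zero_sub, neg_nonpos]
      exact sum_nonneg hnn
  refine le_trans ?_ (bernExp_mono h0 h1 hpt)
  rw [bernExp_sub, bernExp_sum, bernExp_subset_mul, sub_mul, sum_mul]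
  · refine sub_le_sub_left (sum_le_sum fun j _ => ?_) _
    rw [← bernExp_subset p (F i ∪ F j)]
    refine bernExp_mul_le h0 h1 (fun E => by split_ifs <;> norm_num) ?_ (avoidInd_le_one F I)
      (avoidInd_antitone F I)
    intro E E' h
    dsimp only
    split_ifs with h2 h3
    · exact le_rfl
    · exact absurd (h2.trans h) h3
    · norm_num
    · exact le_rfl
  · intro x hx E
    unfold avoidInd
    congr 1
    refine propext (forall₂_congr fun j hj => not_congr ?_)
    rw [subset_insert_iff_of_notMem]
    exact fun h => disjoint_left.1 (mem_filter.1 hj).2 hx h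

variable [DecidableEq ι]

/-- Avoiding fewer sets is likelier, so for d > 0 the preceding bound gives a factor 1 - d ≤
exp(-d). For d ≤ 0 monotonicity suffices. -/
theorem bernExp_avoidInd_insert_le {p : α → ℝ} (h0 : ∀ e, 0 ≤ p e) (h1 : ∀ e, p e ≤ 1)
    (F : ι → Finset α) (i : ι) (S : Finset ι) :
    bernExp p (avoidInd F (insert i S)) ≤ bernExp p (avoidInd F S) *
      Real.exp (-(∏ e ∈ F i, p e -
        ∑ j ∈ S with ¬ Disjoint (F i) (F j), ∏ e ∈ F i ∪ F j, p e)) := by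
  have key := bernExp_subset_mul_avoidInd_ge h0 h1 F i S
  set d := ∏ e ∈ F i, p e - ∑ j ∈ S with ¬ Disjoint (F i) (F j), ∏ e ∈ F i ∪ F j, p e
  have hN0 : 0 ≤ bernExp p (avoidInd F S) := bernExp_nonneg h0 h1 (avoidInd_nonneg F S)
  rcases le_or_gt d 0 with hd | hd
  · calc bernExp p (avoidInd F (insert i S)) ≤ bernExp p (avoidInd F S) :=
          bernExp_mono h0 h1 (avoidInd_anti_index F (subset_insert i S))
      _ ≤ _ := le_mul_of_one_le_right hN0 (Real.one_le_exp (by linarith))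
  · have h2 : bernExp p (avoidInd F S) ≤
        bernExp p (avoidInd F {j ∈ S | Disjoint (F i) (F j)}) :=
      bernExp_mono h0 h1 (avoidInd_anti_index F (filter_subset _ _))
    have h3 := mul_le_mul_of_nonneg_left h2 hd.le
    have h4 : bernExp p (avoidInd F (insert i S)) = bernExp p (avoidInd F S) -
        bernExp p (fun E => (if F i ⊆ E then 1 else 0) * avoidInd F S E) := by
      rw [← bernExp_sub]
      exact congrArg _ (funext fun E => avoidInd_insert F i S E)
    have h5 := mul_le_mul_of_nonneg_left (Real.add_one_le_exp (-d)) hN0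
    rw [h4]
    linarith

/-- The Boppana–Spencer form of Janson's inequality. -/
theorem bernExp_avoidInd_le_exp {p : α → ℝ} (h0 : ∀ e, 0 ≤ p e) (h1 : ∀ e, p e ≤ 1)
    (F : ι → Finset α) (S : Finset ι) :
    bernExp p (avoidInd F S) ≤ Real.exp (-(∑ i ∈ S, ∏ e ∈ F i, p e -
      ∑ i ∈ S, ∑ j ∈ S with j ≠ i ∧ ¬ Disjoint (F i) (F j), ∏ e ∈ F i ∪ F j, p e)) := by
  have hprod : ∀ T : Finset α, 0 ≤ ∏ e ∈ T, p e := fun T => prod_nonneg fun e _ => h0 e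
  induction S using Finset.induction_on with
  | empty =>
    have : avoidInd F ∅ = fun _ => 1 := funext fun E => if_pos (by simp)
    simp [this, bernExp_one]
  | insert i S hi ih =>
    refine (bernExp_avoidInd_insert_le h0 h1 F i S).trans
      ((mul_le_mul_of_nonneg_right ih (Real.exp_nonneg _)).trans ?_)
    rw [← Real.exp_add, Real.exp_le_exp, sum_insert hi, sum_insert hi]
    have h2 : ∑ k ∈ S, ∑ j ∈ S with j ≠ k ∧ ¬ Disjoint (F k) (F j), ∏ e ∈ F k ∪ F j, p e ≤
        ∑ k ∈ S, ∑ j ∈ insert i S with j ≠ k ∧ ¬ Disjoint (F k) (F j), ∏ e ∈ F k ∪ F j, p e :=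
      sum_le_sum fun k _ => sum_le_sum_of_subset_of_nonneg
        (filter_subset_filter _ (subset_insert i S)) fun _ _ _ => hprod _
    have h3 : ∑ j ∈ S with ¬ Disjoint (F i) (F j), ∏ e ∈ F i ∪ F j, p e ≤
        ∑ j ∈ insert i S with j ≠ i ∧ ¬ Disjoint (F i) (F j), ∏ e ∈ F i ∪ F j, p e := by
      refine sum_le_sum_of_subset_of_nonneg (fun j hj => ?_) fun _ _ _ => hprod _
      obtain ⟨hj, hd⟩ := mem_filter.1 hj
      exact mem_filter.2 ⟨mem_insert_of_mem hj, fun h => hi (h ▸ hj), hd⟩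
    linarith

/-- Janson's inequality for a random subfamily of density `q`. -/
theorem bernExp_avoidInd_univ_le_exp [Fintype ι] {p : α → ℝ} (h0 : ∀ e, 0 ≤ p e)
    (h1 : ∀ e, p e ≤ 1) (F : ι → Finset α) {q : ℝ} (hq0 : 0 ≤ q) (hq1 : q ≤ 1) :
    bernExp p (avoidInd F univ) ≤ Real.exp (-(q * ∑ i, ∏ e ∈ F i, p e -
      q ^ 2 * ∑ i, ∑ j with j ≠ i ∧ ¬ Disjoint (F i) (F j), ∏ e ∈ F i ∪ F j, p e)) := by
  -- Keep each index with probability q: single terms survive with probability q and pairs with q²,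
  -- so some S does at least as well as this expectation.
  obtain ⟨S, hS⟩ := exists_bernExp_le (p := fun _ : ι => q) (fun _ => hq0) (fun _ => hq1)
    (fun S => ∑ i, (∏ e ∈ F i, p e) * (if {i} ⊆ S then 1 else 0) -
      ∑ i, ∑ j with j ≠ i ∧ ¬ Disjoint (F i) (F j),
        (∏ e ∈ F i ∪ F j, p e) * (if {i, j} ⊆ S then 1 else 0))
  refine (bernExp_mono h0 h1 (avoidInd_anti_index F (subset_univ S))).trans
    ((bernExp_avoidInd_le_exp h0 h1 F S).trans ?_)
  rw [Real.exp_le_exp, neg_le_neg_iff]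
  refine le_trans (le_of_eq ?_) (hS.trans (le_of_eq ?_))
  · simp only [bernExp_sub, bernExp_sum, bernExp_const_mul, bernExp_subset, mul_sum]
    congr 1
    · exact sum_congr rfl fun i _ => by rw [prod_singleton, mul_comm]
    · refine sum_congr rfl fun i _ => sum_congr rfl fun j hj => ?_
      rw [prod_pair (mem_filter.1 hj).2.1.symm]
      ring
  · simp only [mul_ite, mul_one, mul_zero, singleton_subset_iff, insert_subset_iff]
    congr 1
    · rw [← sum_filter, filter_mem_eq_inter, univ_inter]
    · rw [← sum_subset (subset_univ S) fun i _ hi => sum_eq_zero fun j _ => by simp [hi]]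
      refine sum_congr rfl fun i hi => ?_
      rw [← sum_filter, filter_filter]
      refine sum_congr (Finset.ext fun j => ?_) fun _ _ => rfl
      simp only [mem_filter, mem_univ, true_and, hi]
      tauto

end Janson

end

/-! ### Blocks whose transversals every given permutation orders by color class. -/

section

section Separation

variable {n : ℕ}

/-- In the ordering `π`, one of the sets `A`, `B` precedes the other. -/
def Separates (π : Equiv.Perm (Fin n)) (A B : Finset (Fin n)) : Prop :=
  (∀ a ∈ A, ∀ b ∈ B, π a < π b) ∨ ∀ a ∈ A, ∀ b ∈ B, π b < π a

theorem Separates.mono {π : Equiv.Perm (Fin n)} {A B A' B' : Finset (Fin n)}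
    (h : Separates π A B) (hA : A' ⊆ A) (hB : B' ⊆ B) : Separates π A' B' :=
  h.imp (fun h a ha b hb => h a (hA ha) b (hB hb)) fun h a ha b hb => h a (hA ha) b (hB hb)

theorem card_filter_lt_succ_le (π : Equiv.Perm (Fin n)) (A : Finset (Fin n)) (j : ℕ) :
    #{a ∈ A | (π a : ℕ) < j + 1} ≤ #{a ∈ A | (π a : ℕ) < j} + 1 := by
  have h : {a ∈ A | (π a : ℕ) < j + 1} ⊆
      {a ∈ A | (π a : ℕ) < j} ∪ {a ∈ A | (π a : ℕ) = j} := by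
    intro a
    simp only [mem_union, mem_filter]
    rintro ⟨ha, h⟩
    rcases Nat.lt_succ_iff_lt_or_eq.1 h with h | h
    · exact Or.inl ⟨ha, h⟩
    · exact Or.inr ⟨ha, h⟩
  have h1 : #{a ∈ A | (π a : ℕ) = j} ≤ 1 := card_le_one.2 fun a ha b hb =>
    π.injective (Fin.ext ((mem_filter.1 ha).2.trans (mem_filter.1 hb).2.symm))
  exact (card_le_card h).trans ((card_union_le _ _).trans (by omega))

/-- Cut the ordering at the first position by which A or B has M elements. Since one position holds
one vertex, neither has more than M before the cut, so the other set still has M after it. -/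
theorem exists_separates (π : Equiv.Perm (Fin n)) {A B : Finset (Fin n)} {M : ℕ}
    (hA : 2 * M ≤ #A) (hB : 2 * M ≤ #B) :
    ∃ A' ⊆ A, ∃ B' ⊆ B, M ≤ #A' ∧ M ≤ #B' ∧ Separates π A' B' := by
  classical
  have hex : ∃ k : ℕ, M ≤ #{a ∈ A | (π a : ℕ) < k} ∨ M ≤ #{a ∈ B | (π a : ℕ) < k} := by
    refine ⟨n, Or.inl ?_⟩
    rw [filter_true_of_mem fun a _ => (π a).2]
    omega
  obtain ⟨k, hk, hfA, hfB⟩ : ∃ k : ℕ,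
      (M ≤ #{a ∈ A | (π a : ℕ) < k} ∨ M ≤ #{a ∈ B | (π a : ℕ) < k}) ∧
      #{a ∈ A | (π a : ℕ) < k} ≤ M ∧ #{a ∈ B | (π a : ℕ) < k} ≤ M := by
    refine ⟨Nat.find hex, Nat.find_spec hex, ?_⟩
    rcases Nat.eq_zero_or_pos (Nat.find hex) with h | h
    · simp [h]
    · obtain ⟨j, hj⟩ := Nat.exists_eq_succ_of_ne_zero h.ne'
      have hmin := Nat.find_min hex (m := j) (by omega)
      have h1 := card_filter_lt_succ_le π A j
      have h2 := card_filter_lt_succ_le π B j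
      rw [hj, Nat.succ_eq_add_one]
      omega
  have eA := card_filter_add_card_filter_not (s := A) (fun a => (π a : ℕ) < k)
  have eB := card_filter_add_card_filter_not (s := B) (fun a => (π a : ℕ) < k)
  rcases hk with hk | hk
  · refine ⟨_, filter_subset (fun a => (π a : ℕ) < k) A, _,
      filter_subset (fun a => ¬ (π a : ℕ) < k) B, hk, by omega, Or.inl fun a ha b hb => ?_⟩
    have h1 := (mem_filter.1 ha).2
    have h2 := (mem_filter.1 hb).2
    exact Fin.lt_def.2 (by omega)
  · refine ⟨_, filter_subset (fun a => ¬ (π a : ℕ) < k) A, _,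
      filter_subset (fun a => (π a : ℕ) < k) B, by omega, hk, Or.inr fun a ha b hb => ?_⟩
    have h1 := (mem_filter.1 ha).2
    have h2 := (mem_filter.1 hb).2
    exact Fin.lt_def.2 (by omega)

/-- Each requirement costs at most a factor of two in size, and separation survives passing to
subsets. -/
theorem exists_separates_family {ι : Type*} (T : Finset (Equiv.Perm (Fin n) × ι × ι))
    (hT : ∀ t ∈ T, t.2.1 ≠ t.2.2) (M : ℕ) (A : ι → Finset (Fin n))
    (hA : ∀ c, 2 ^ #T * M ≤ #(A c)) :
    ∃ A' : ι → Finset (Fin n), (∀ c, M ≤ #(A' c)) ∧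
      ∀ t ∈ T, Separates t.1 (A' t.2.1) (A' t.2.2) := by
  classical
  induction T using Finset.induction_on generalizing M with
  | empty => exact ⟨A, by simpa using hA, by simp⟩
  | insert t T ht ih =>
    obtain ⟨A₁, hM, hsep⟩ := ih (fun s hs => hT s (mem_insert_of_mem hs)) (2 * M) fun c => by
      have := hA c
      rw [card_insert_of_notMem ht, pow_succ] at this
      linarith
    obtain ⟨B, hB, B', hB', hBM, hBM', hs⟩ :=
      exists_separates t.1 (hM t.2.1) (hM t.2.2)
    have hne := hT t (mem_insert_self t T)
    have hsub : ∀ c, Function.update (Function.update A₁ t.2.1 B) t.2.2 B' c ⊆ A₁ c := by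
      intro c
      by_cases h2 : c = t.2.2
      · subst h2; simpa using hB'
      · by_cases h1 : c = t.2.1
        · subst h1; simpa [hne] using hB
        · simp [h1, h2]
    refine ⟨Function.update (Function.update A₁ t.2.1 B) t.2.2 B', fun c => ?_, fun s hs' => ?_⟩
    · by_cases h2 : c = t.2.2
      · subst h2; simpa using hBM'
      · by_cases h1 : c = t.2.1
        · subst h1; simpa [hne] using hBM
        · have := hM c
          simp only [ne_eq, h2, not_false_eq_true, Function.update_of_ne, h1]
          omega
    · rcases mem_insert.1 hs' with rfl | hs'
      · simpa [hne] using hs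
      · exact (hsep s hs').mono (hsub _) (hsub _)

end Separation

variable {V : Type*} [Fintype V]

/-- Disjoint blocks of size `N`, one for each vertex, such that each `π ∈ X` orders every
transversal of the blocks in a way that respects `C`. -/
theorem exists_blocks_respecting (C : V → ℕ) {n N : ℕ} (X : Finset (Equiv.Perm (Fin n)))
    (hn : 2 ^ ((#X + 1) * Fintype.card V ^ 2) * (Fintype.card V * N) ≤ n) :
    ∃ b : V × Fin N ↪ Fin n, ∀ f : V → Fin N, ∀ π ∈ X,
      ∃ σ : V ≃ Fin (Fintype.card V), Respects σ C ∧
        ∀ u v, σ u < σ v ↔ π (b (u, f u)) < π (b (v, f v)) := by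
  classical
  let ι := (univ.image C : Finset ℕ)
  let col : V → ι := fun v => ⟨C v, mem_image_of_mem C (mem_univ v)⟩
  have hι : Fintype.card ι ≤ Fintype.card V := by
    rw [Fintype.card_coe]
    exact card_image_le
  -- There is one set per color, all starting as the whole vertex set. Adding the identity to X
  -- forces the final sets to be pairwise disjoint; blocks of the same color are then carved from
  -- one set.
  obtain ⟨A, hA, hsep⟩ := exists_separates_family
    (insert 1 X ×ˢ (univ : Finset ι).offDiag)
    (fun t ht => (mem_offDiag.1 (mem_product.1 ht).2).2.2) (Fintype.card V * N) (fun _ => univ)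
    fun c => by
      refine le_trans (Nat.mul_le_mul_right _ (Nat.pow_le_pow_right (by norm_num) ?_)) (hn.trans ?_)
      · rw [card_product, offDiag_card, card_univ]
        refine Nat.mul_le_mul (card_insert_le _ _) ((Nat.sub_le _ _).trans ?_)
        rw [sq]
        exact Nat.mul_le_mul hι hι
      · simp
  have hemb : ∀ c, Nonempty (V × Fin N ↪ A c) := fun c =>
    Function.Embedding.nonempty_of_card_le (by simpa using hA c)
  have emb := fun c => (hemb c).some
  have hS : ∀ π ∈ insert 1 X, ∀ c d, c ≠ d → Separates π (A c) (A d) := fun π hπ c d hcd =>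
    hsep (π, c, d) (mem_product.2 ⟨hπ, mem_offDiag.2 ⟨mem_univ _, mem_univ _, hcd⟩⟩)
  let b : V × Fin N ↪ Fin n := ⟨fun x => (emb (col x.1) x : Fin n), by
    intro x y h
    by_cases hc : col x.1 = col y.1
    · dsimp only at h
      rw [hc] at h
      exact (emb (col y.1)).injective (Subtype.ext h)
    · dsimp only at h
      have hx := (emb (col x.1) x).2
      have hy := (emb (col y.1) y).2
      rw [← h] at hy
      rcases hS 1 (mem_insert_self 1 X) _ _ hc with h' | h'
      · exact absurd (h' _ hx _ hy) (lt_irrefl _)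
      · exact absurd (h' _ hx _ hy) (lt_irrefl _)⟩
  have hbA : ∀ v i, b (v, i) ∈ A (col v) := fun v i => (emb (col v) (v, i)).2
  refine ⟨b, fun f π hπ => ?_⟩
  obtain ⟨σ, hσ⟩ := exists_equiv_fin_lt_iff (fun v => π (b (v, f v))) fun u v h =>
    congrArg Prod.fst (b.injective (π.injective h))
  refine ⟨σ, fun u v w huv hvw hC => ?_, hσ⟩
  by_contra hne
  rw [hσ] at huv hvw
  have hcw : col u = col w := Subtype.ext hC
  have hcv : col u ≠ col v := fun h => hne (congrArg Subtype.val h).symm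
  have hw := hbA w (f w)
  rw [← hcw] at hw
  rcases hS π (mem_insert_of_mem hπ) _ _ hcv with h | h
  · exact absurd (hvw.trans (h _ hw _ (hbA v (f v)))) (lt_irrefl _)
  · exact absurd (huv.trans (h _ (hbA u (f u)) _ (hbA v (f v)))) (lt_irrefl _)

open Classical in
/-- The arcs of the transversal copy of `H` given by `f`, for blocks indexed by `b`. -/
noncomputable def transversalArcs (H : Digraph V) {n N : ℕ} (b : V × Fin N ↪ Fin n)
    (f : V → Fin N) : Finset (Fin n × Fin n) :=
  (arcs H).image fun e => (b (e.1, f e.1), b (e.2, f e.2))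

/-- Pulling π back along the copy gives an ordering of V(H) that covers the corresponding arcs. -/
theorem Copy.numCovered_le {H : Digraph V} {n : ℕ} {G : Digraph (Fin n)} (φ : Copy H G)
    (π : Equiv.Perm (Fin n)) {k : ℕ} (σ : V ≃ Fin k)
    (h : ∀ u v, σ u < σ v ↔ π (φ.toEmb u) < π (φ.toEmb v)) :
    φ.numCovered π ≤ #(DagCover.arcs (leftGraph H σ)) := by
  classical
  rw [Copy.numCovered, ← card_map (φ.toEmb.prodMap φ.toEmb)]
  refine card_le_card fun x hx => ?_
  obtain ⟨h1, h2⟩ := mem_inter.1 hx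
  obtain ⟨e, he, rfl⟩ := mem_map.1 h1
  refine mem_map_of_mem _ ?_
  rw [mem_arcs] at he h2 ⊢
  exact ⟨he, (h _ _).2 h2.2⟩

theorem exists_copy_of_transversal (H : Digraph V) {n N : ℕ} {E : Finset (Fin n × Fin n)}
    (b : V × Fin N ↪ Fin n) (f : V → Fin N) (h : transversalArcs H b f ⊆ E) :
    ∃ φ : Copy H (ofArcs E), ∀ v, φ.toEmb v = b (v, f v) := by
  classical
  exact ⟨⟨⟨fun v => b (v, f v), fun u v h => congrArg Prod.fst (b.injective h)⟩,
    fun u v huv => h (mem_image.2 ⟨(u, v), mem_arcs.2 huv, rfl⟩)⟩, fun _ => rfl⟩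

/-- If every family of blocks has a transversal copy in `E`, then `E` has a copy of `H` of which
each `π ∈ X` covers at most `s(H)` arcs. -/
theorem exists_copy_numCovered_le_skewness (H : Digraph V) {n N : ℕ} {E : Finset (Fin n × Fin n)}
    (hE : ∀ b : V × Fin N ↪ Fin n, ∃ f, transversalArcs H b f ⊆ E)
    (X : Finset (Equiv.Perm (Fin n)))
    (hn : 2 ^ ((#X + 1) * Fintype.card V ^ 2) * (Fintype.card V * N) ≤ n) :
    ∃ φ : Copy H (ofArcs E), ∀ π ∈ X, φ.numCovered π ≤ skewness H := by
  obtain ⟨C, hC⟩ := exists_coloringSkewness_eq H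
  obtain ⟨b, hb⟩ := exists_blocks_respecting C X hn
  obtain ⟨f, hf⟩ := hE b
  obtain ⟨φ, hφ⟩ := exists_copy_of_transversal H b f hf
  refine ⟨φ, fun π hπ => ?_⟩
  obtain ⟨σ, hσC, hσ⟩ := hb f π hπ
  rw [← hC]
  exact (φ.numCovered_le π σ fun u v => by rw [hφ, hφ, hσ]).trans (card_arcs_leftGraph_le H hσC)

end

/-! ### Transversal copies: second moment, Janson bound and union bound. -/

section

variable {V : Type*} [Fintype V]

open Classical in
/-- The arcs of `H` inside `S`. -/
noncomputable def arcsIn (H : Digraph V) (S : Finset V) : Finset (V × V) :=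
  {e ∈ arcs H | e.1 ∈ S ∧ e.2 ∈ S}

theorem arcsIn_univ (H : Digraph V) : arcsIn H univ = arcs H := by
  simp [arcsIn]

/-- The arc probabilities of the random digraph, viewed on all ordered pairs. -/
def arcProb (n : ℕ) (p : ℝ) (e : Fin n × Fin n) : ℝ :=
  if e.1 = e.2 then 0 else p

theorem prod_arcProb {n : ℕ} (p : ℝ) {F : Finset (Fin n × Fin n)} (hF : ∀ e ∈ F, e.1 ≠ e.2) :
    ∏ e ∈ F, arcProb n p e = p ^ #F := by
  rw [← prod_const]
  exact prod_congr rfl fun e he => if_neg (hF e he)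

theorem transversal_map_injective {V : Type*} {n N : ℕ} (b : V × Fin N ↪ Fin n) (f : V → Fin N) :
    Function.Injective fun e : V × V => (b (e.1, f e.1), b (e.2, f e.2)) := by
  intro e e' h
  have h1 := congrArg Prod.fst (b.injective (Prod.ext_iff.1 h).1)
  have h2 := congrArg Prod.fst (b.injective (Prod.ext_iff.1 h).2)
  exact Prod.ext h1 h2

section Transversal

variable (H : Digraph V) {n N : ℕ} (b : V × Fin N ↪ Fin n)

theorem card_transversalArcs (f : V → Fin N) : #(transversalArcs H b f) = #(arcs H) := by
  classical
  exact card_image_of_injective _ (transversal_map_injective b f)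

variable {H} in
theorem transversalArcs_ne (hH : IsDag H) (f : V → Fin N) :
    ∀ e ∈ transversalArcs H b f, e.1 ≠ e.2 := by
  classical
  intro e he h
  obtain ⟨x, hx, rfl⟩ := mem_image.1 he
  have h1 : x.1 = x.2 := congrArg Prod.fst (b.injective h)
  rw [mem_arcs, ← h1] at hx
  exact hH.irrefl _ hx

/-- Blocks are disjoint, so a shared arc comes from the same arc of H in both copies, with both ends
in the agreement set. -/
theorem card_transversalArcs_inter (f g : V → Fin N) :
    #(transversalArcs H b f ∩ transversalArcs H b g) = #(arcsIn H {v | f v = g v}) := by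
  classical
  rw [← card_image_of_injective _ (transversal_map_injective b f)]
  congr 1
  ext x
  simp only [transversalArcs, mem_inter, mem_image, arcsIn, mem_filter, mem_univ, true_and]
  constructor
  · rintro ⟨⟨e, he, rfl⟩, e', he', h⟩
    have h1 := b.injective (Prod.ext_iff.1 h).1
    have h2 := b.injective (Prod.ext_iff.1 h).2
    simp only [Prod.mk.injEq] at h1 h2
    obtain ⟨h1, h1'⟩ := h1
    obtain ⟨h2, h2'⟩ := h2
    rw [h1] at h1'
    rw [h2] at h2'
    exact ⟨e, ⟨he, h1'.symm, h2'.symm⟩, rfl⟩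
  · rintro ⟨e, ⟨he, h1, h2⟩, rfl⟩
    exact ⟨⟨e, he, rfl⟩, e, he, by rw [h1, h2]⟩

variable {H} in
theorem two_le_card_of_arcsIn (hH : IsDag H) {S : Finset V} (h : (arcsIn H S).Nonempty) :
    2 ≤ #S := by
  classical
  obtain ⟨e, he⟩ := h
  obtain ⟨he, h1, h2⟩ := mem_filter.1 he
  exact one_lt_card.2 ⟨e.1, h1, e.2, h2, fun h => hH.irrefl e.1 (by
    have := mem_arcs.1 he
    rwa [← h] at this)⟩

end Transversal

theorem card_filter_agree_mul_pow {N : ℕ} [DecidableEq V] (f : V → Fin N) (S : Finset V) :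
    #{g : V → Fin N | ∀ v ∈ S, f v = g v} * N ^ #S = N ^ Fintype.card V := by
  have h : ({g : V → Fin N | ∀ v ∈ S, f v = g v} : Finset _) =
      Fintype.piFinset fun v => if v ∈ S then {f v} else univ := by
    ext g
    simp only [mem_filter, mem_univ, true_and, Fintype.mem_piFinset]
    refine forall_congr' fun v => ?_
    by_cases hv : v ∈ S <;> simp [hv, eq_comm]
  have h2 : N ^ #S = ∏ v, if v ∈ S then N else 1 := by
    rw [prod_ite_mem, univ_inter, prod_const]
  rw [h, Fintype.card_piFinset, h2, ← prod_mul_distrib, ← card_univ, ← prod_const]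
  refine prod_congr rfl fun v _ => ?_
  by_cases hv : v ∈ S <;> simp [hv]

/-- The expected number of pairs of intersecting transversal copies. -/
theorem sum_transversalArcs_union_le [DecidableEq V] {H : Digraph V} (hH : IsDag H) {n N : ℕ}
    (b : V × Fin N ↪ Fin n) {p Y : ℝ} (hp : 0 < p) (hY : 0 < Y)
    (hS : ∀ S : Finset V, 2 ≤ #S → Y ≤ (N : ℝ) ^ #S * p ^ #(arcsIn H S)) :
    ∑ f : V → Fin N, ∑ g : V → Fin N with
        g ≠ f ∧ ¬ Disjoint (transversalArcs H b f) (transversalArcs H b g),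
      ∏ e ∈ transversalArcs H b f ∪ transversalArcs H b g, arcProb n p e ≤
    ((N : ℝ) ^ Fintype.card V * p ^ #(arcs H)) ^ 2 * (2 ^ Fintype.card V / Y) := by
  classical
  have hpair : ∀ f g : V → Fin N,
      ∏ e ∈ transversalArcs H b f ∪ transversalArcs H b g, arcProb n p e =
        (p ^ #(arcs H)) ^ 2 / p ^ #(arcsIn H {v | f v = g v}) := by
    intro f g
    rw [prod_arcProb p fun e he => (mem_union.1 he).elim (transversalArcs_ne b hH f e)
      (transversalArcs_ne b hH g e), eq_div_iff (by positivity), ← pow_add, ← pow_mul]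
    have := card_union_add_card_inter (transversalArcs H b f) (transversalArcs H b g)
    rw [card_transversalArcs_inter, card_transversalArcs, card_transversalArcs] at this
    congr 1
    omega
  have hrow : ∀ f : V → Fin N, ∑ g : V → Fin N with
        g ≠ f ∧ ¬ Disjoint (transversalArcs H b f) (transversalArcs H b g),
      ∏ e ∈ transversalArcs H b f ∪ transversalArcs H b g, arcProb n p e ≤
      (p ^ #(arcs H)) ^ 2 * ((N : ℝ) ^ Fintype.card V * (2 ^ Fintype.card V / Y)) := by
    intro f
    -- The maps g agreeing with f on S are a fraction N^(-|S|) of all maps, so the hypothesis on Y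
    -- bounds the contribution of S by that of all maps times 1/Y.
    have hterm : ∀ S ∈ ({S | 2 ≤ #S} : Finset (Finset V)),
        ∑ g : V → Fin N with ∀ v ∈ S, f v = g v, (p ^ #(arcs H)) ^ 2 / p ^ #(arcsIn H S) ≤
        (p ^ #(arcs H)) ^ 2 * ((N : ℝ) ^ Fintype.card V / Y) := by
      intro S hS2
      have hYS := hS S (mem_filter.1 hS2).2
      have hc : (#{g : V → Fin N | ∀ v ∈ S, f v = g v} : ℝ) * (N : ℝ) ^ #S =
        (N : ℝ) ^ Fintype.card V := by exact_mod_cast card_filter_agree_mul_pow f S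
      rw [sum_const, nsmul_eq_mul, ← hc, ← mul_div_assoc, ← mul_div_assoc, div_le_div_iff₀
        (by positivity) hY]
      have := mul_le_mul_of_nonneg_left hYS (show 0 ≤
        (#{g : V → Fin N | ∀ v ∈ S, f v = g v} : ℝ) * (p ^ #(arcs H)) ^ 2 by positivity)
      refine this.trans (le_of_eq ?_)
      ring
    have hw : ∀ (g : V → Fin N) (S : Finset V), 0 ≤
        if ∀ v ∈ S, f v = g v then (p ^ #(arcs H)) ^ 2 / p ^ #(arcsIn H S) else 0 :=
      fun g S => by split_ifs <;> positivity
    have hagree : ∀ g ∈ ({g | g ≠ f ∧ ¬ Disjoint (transversalArcs H b f)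
        (transversalArcs H b g)} : Finset (V → Fin N)),
        ∏ e ∈ transversalArcs H b f ∪ transversalArcs H b g, arcProb n p e ≤
        ∑ S : Finset V with 2 ≤ #S,
          if ∀ v ∈ S, f v = g v then (p ^ #(arcs H)) ^ 2 / p ^ #(arcsIn H S) else 0 := by
      intro g hg
      have hg := (mem_filter.1 hg).2.2
      rw [not_disjoint_iff_nonempty_inter, ← card_pos, card_transversalArcs_inter,
        card_pos] at hg
      have h := single_le_sum (s := ({S | 2 ≤ #S} : Finset (Finset V)))
        (f := fun S : Finset V => if ∀ v ∈ S, f v = g v then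
          (p ^ #(arcs H)) ^ 2 / p ^ #(arcsIn H S) else 0)
        (fun S _ => hw g S)
        (mem_filter.2 ⟨mem_univ ({v | f v = g v} : Finset V), two_le_card_of_arcsIn hH hg⟩)
      rwa [if_pos fun v hv => (mem_filter.1 hv).2, ← hpair] at h
    calc _ ≤ ∑ g : V → Fin N, ∑ S : Finset V with 2 ≤ #S,
          if ∀ v ∈ S, f v = g v then (p ^ #(arcs H)) ^ 2 / p ^ #(arcsIn H S) else 0 :=
          (sum_le_sum hagree).trans (sum_le_sum_of_subset_of_nonneg (filter_subset _ _)
            fun g _ _ => sum_nonneg fun S _ => hw g S)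
      _ = ∑ S : Finset V with 2 ≤ #S, ∑ g : V → Fin N with ∀ v ∈ S, f v = g v,
            (p ^ #(arcs H)) ^ 2 / p ^ #(arcsIn H S) := by
          rw [sum_comm]
          exact sum_congr rfl fun S _ => (sum_filter _ _).symm
      _ ≤ ∑ S : Finset V with 2 ≤ #S, (p ^ #(arcs H)) ^ 2 * ((N : ℝ) ^ Fintype.card V / Y) :=
          sum_le_sum hterm
      _ ≤ _ := by
          rw [sum_const, nsmul_eq_mul]
          have hcard : (#{S : Finset V | 2 ≤ #S} : ℝ) ≤ 2 ^ Fintype.card V := by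
            have := card_filter_le (univ : Finset (Finset V)) (fun S => 2 ≤ #S)
            rw [card_univ, Fintype.card_finset] at this
            exact_mod_cast this
          refine (mul_le_mul_of_nonneg_right hcard (by positivity)).trans (le_of_eq ?_)
          ring
  refine (sum_le_sum fun f _ => hrow f).trans (le_of_eq ?_)
  rw [sum_const, card_univ, Fintype.card_fun, Fintype.card_fin, nsmul_eq_mul, Nat.cast_pow]
  ring

/-- The probability that no transversal of the given blocks spans a copy of `H`. -/
theorem bernExp_avoid_transversal_le [DecidableEq V] {H : Digraph V} (hH : IsDag H) (hV : 2 ≤ Fintype.card V)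
    {n N : ℕ} (b : V × Fin N ↪ Fin n) {p Y : ℝ} (hp : 0 < p) (hp1 : p ≤ 1) (hY : 0 < Y)
    (hS : ∀ S : Finset V, 2 ≤ #S → Y ≤ (N : ℝ) ^ #S * p ^ #(arcsIn H S)) :
    bernExp (arcProb n p) (avoidInd (transversalArcs H b) univ) ≤
      Real.exp (-(Y / 2 ^ (Fintype.card V + 2))) := by
  classical
  have hD := sum_transversalArcs_union_le hH b hp hY hS
  have hμ : ∑ f : V → Fin N, ∏ e ∈ transversalArcs H b f, arcProb n p e =
      (N : ℝ) ^ Fintype.card V * p ^ #(arcs H) := by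
    simp only [prod_arcProb p (transversalArcs_ne b hH _), card_transversalArcs, sum_const,
      card_univ, Fintype.card_fun, Fintype.card_fin, nsmul_eq_mul, Nat.cast_pow]
  have hYμ := hS univ (by simpa using hV)
  rw [card_univ, arcsIn_univ] at hYμ
  set μ := (N : ℝ) ^ Fintype.card V * p ^ #(arcs H) with hμdef
  have hμ0 : 0 < μ := hY.trans_le hYμ
  have h2 : (1 : ℝ) ≤ 2 ^ (Fintype.card V + 1) := one_le_pow₀ (by norm_num)
  -- This density q gives qμ = Y/2^(h+1), while the pair term is at most half of that, leaving
  -- Y/2^(h+2). It is at most 1 because the hypothesis for S = V reads Y ≤ μ.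
  have hq1 : Y / (2 ^ (Fintype.card V + 1) * μ) ≤ 1 := by
    rw [div_le_one (by positivity)]
    nlinarith
  refine (bernExp_avoidInd_univ_le_exp (fun e => ?_) (fun e => ?_) (transversalArcs H b)
    (q := Y / (2 ^ (Fintype.card V + 1) * μ)) (by positivity) hq1).trans ?_
  · unfold arcProb; split_ifs <;> linarith
  · unfold arcProb; split_ifs <;> linarith
  rw [Real.exp_le_exp, neg_le_neg_iff, hμ]
  have h3 := mul_le_mul_of_nonneg_left hD (sq_nonneg (Y / (2 ^ (Fintype.card V + 1) * μ)))
  have e1 : Y / (2 ^ (Fintype.card V + 1) * μ) * μ -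
      (Y / (2 ^ (Fintype.card V + 1) * μ)) ^ 2 * (μ ^ 2 * (2 ^ Fintype.card V / Y)) =
      Y / 2 ^ (Fintype.card V + 2) := by
    rw [pow_add, pow_add]
    field_simp
    norm_num
  linarith

open Classical in
-- Loops get probability 0, so arc sets with a loop have weight 0 and absent loops contribute
-- factors 1.
theorem randDigraphProb_eq_bernExp (n : ℕ) (p : ℝ) (P : Digraph (Fin n) → Prop) :
    randDigraphProb n p P =
      bernExp (arcProb n p) fun E => if P (ofArcs E) then 1 else 0 := by
  unfold randDigraphProb bernExp
  simp only [mul_ite, mul_one, mul_zero]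
  rw [sum_filter]
  have h : ∀ E : Finset (Fin n × Fin n), bernWeight (arcProb n p) E =
      if E ⊆ (univ : Finset (Fin n)).offDiag then
        ∏ e ∈ (univ : Finset (Fin n)).offDiag, if e ∈ E then p else 1 - p else 0 := by
    intro E
    unfold bernWeight
    split_ifs with hE
    · rw [← prod_subset (subset_univ (univ : Finset (Fin n)).offDiag)]
      · refine prod_congr rfl fun e he => ?_
        rw [arcProb, if_neg (mem_offDiag.1 he).2.2]
      · intro e _ he
        have hd : e.1 = e.2 := by
          by_contra h
          exact he (mem_offDiag.2 ⟨mem_univ _, mem_univ _, h⟩)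
        rw [arcProb, if_pos hd, if_neg fun h => he (hE h), sub_zero]
    · obtain ⟨e, he, hne⟩ := not_subset.1 hE
      have hd : e.1 = e.2 := by
        by_contra h
        exact hne (mem_offDiag.2 ⟨mem_univ _, mem_univ _, h⟩)
      exact prod_eq_zero (mem_univ e) (by rw [if_pos he, arcProb, if_pos hd])
  rw [← sum_subset (subset_univ (univ : Finset (Fin n)).offDiag.powerset)]
  · refine sum_congr rfl fun E hE => ?_
    rw [h, if_pos (mem_powerset.1 hE)]
  · intro E _ hE
    rw [h, if_neg fun h => hE (mem_powerset.2 h), ite_self]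

theorem randDigraphProb_le_one (n : ℕ) {p : ℝ} (hp0 : 0 ≤ p) (hp1 : p ≤ 1)
    (P : Digraph (Fin n) → Prop) : randDigraphProb n p P ≤ 1 := by
  classical
  rw [randDigraphProb_eq_bernExp]
  refine (bernExp_mono (g := fun _ => 1) (fun e => ?_) (fun e => ?_) fun E => ?_).trans_eq
    (bernExp_one _)
  · unfold arcProb; split_ifs <;> linarith
  · unfold arcProb; split_ifs <;> linarith
  · split_ifs <;> norm_num

/-- The union bound over all families of blocks. -/
theorem one_sub_le_randDigraphProb {H : Digraph V} (hH : IsDag H) (hV : 2 ≤ Fintype.card V)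
    {n N : ℕ} {p Y : ℝ} (hp : 0 < p) (hp1 : p ≤ 1) (hY : 0 < Y)
    (hS : ∀ S : Finset V, 2 ≤ #S → Y ≤ (N : ℝ) ^ #S * p ^ #(arcsIn H S))
    {P : Digraph (Fin n) → Prop}
    (hP : ∀ E : Finset (Fin n × Fin n),
      (∀ b : V × Fin N ↪ Fin n, ∃ f, transversalArcs H b f ⊆ E) → P (ofArcs E)) :
    1 - (n : ℝ) ^ (Fintype.card V * N) * Real.exp (-(Y / 2 ^ (Fintype.card V + 2))) ≤
      randDigraphProb n p P := by
  classical
  have h0 : ∀ e, 0 ≤ arcProb n p e := fun e => by unfold arcProb; split_ifs <;> linarith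
  have h1 : ∀ e, arcProb n p e ≤ 1 := fun e => by unfold arcProb; split_ifs <;> linarith
  have hcard : (Fintype.card (V × Fin N ↪ Fin n) : ℝ) ≤ (n : ℝ) ^ (Fintype.card V * N) := by
    have := Fintype.card_le_of_injective
      (fun b : V × Fin N ↪ Fin n => (b : V × Fin N → Fin n)) DFunLike.coe_injective
    rw [Fintype.card_fun, Fintype.card_fin, Fintype.card_prod, Fintype.card_fin] at this
    exact_mod_cast this
  have hsum : bernExp (arcProb n p) (fun E => 1 - ∑ b : V × Fin N ↪ Fin n,
      avoidInd (transversalArcs H b) univ E) ≤ randDigraphProb n p P := by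
    rw [randDigraphProb_eq_bernExp]
    refine bernExp_mono h0 h1 fun E => ?_
    have hnn : ∀ b ∈ (univ : Finset (V × Fin N ↪ Fin n)),
      0 ≤ avoidInd (transversalArcs H b) univ E := fun b _ => avoidInd_nonneg _ _ _
    split_ifs with hPE
    · linarith [sum_nonneg hnn]
    · have : ∃ b : V × Fin N ↪ Fin n, ∀ f, ¬ transversalArcs H b f ⊆ E := by
        by_contra! h
        exact hPE (hP E h)
      obtain ⟨b, hb⟩ := this
      have h := single_le_sum hnn (mem_univ b)
      rw [avoidInd, if_pos fun f _ => hb f] at h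
      linarith
  rw [bernExp_sub, bernExp_one, bernExp_sum] at hsum
  refine le_trans (sub_le_sub_left ?_ 1) hsum
  refine (sum_le_sum fun b _ => bernExp_avoid_transversal_le hH hV b hp hp1 hY hS).trans ?_
  rw [sum_const, nsmul_eq_mul, card_univ]
  exact mul_le_mul_of_nonneg_right hcard (Real.exp_nonneg _)

end

/-! ### Fractional arboricity and the choice of exponents. -/

section

variable {V : Type*} [Fintype V]

theorem bddAbove_fracArboricity (H : Digraph V) :
    BddAbove {x : ℝ | ∃ (S : Finset V) (F : Finset (V × V)), 2 ≤ #S ∧ F ⊆ arcs H ∧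
      (∀ e ∈ F, e.1 ∈ S ∧ e.2 ∈ S) ∧ x = (#F : ℝ) / ((#S : ℝ) - 1)} := by
  refine ⟨#(arcs H), ?_⟩
  rintro x ⟨S, F, hS, hF, -, rfl⟩
  have h1 : (2 : ℝ) ≤ #S := by exact_mod_cast hS
  have h2 : (#F : ℝ) ≤ #(arcs H) := by exact_mod_cast card_le_card hF
  exact (div_le_self (by positivity) (by linarith)).trans h2

theorem card_arcsIn_le (H : Digraph V) {S : Finset V} (hS : 2 ≤ #S) :
    (#(arcsIn H S) : ℝ) ≤ fracArboricity H * ((#S : ℝ) - 1) := by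
  classical
  have h1 : (2 : ℝ) ≤ #S := by exact_mod_cast hS
  rw [← div_le_iff₀ (by linarith)]
  exact le_csSup (bddAbove_fracArboricity H)
    ⟨S, arcsIn H S, hS, filter_subset _ _, fun e he => (mem_filter.1 he).2, rfl⟩

theorem fracArboricity_nonneg (H : Digraph V) : 0 ≤ fracArboricity H := by
  refine Real.sSup_nonneg ?_
  rintro x ⟨S, F, hS, -, -, rfl⟩
  have h1 : (2 : ℝ) ≤ #S := by exact_mod_cast hS
  exact div_nonneg (by positivity) (by linarith)

theorem two_le_card_of_isDag {H : Digraph V} (hH : IsDag H) (hm : 0 < #(arcs H)) :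
    2 ≤ Fintype.card V := by
  have h : (arcsIn H univ).Nonempty := by
    rw [arcsIn_univ]
    exact card_pos.1 hm
  simpa using two_le_card_of_arcsIn hH h

/-- Every vertex set spans many transversal copies in expectation. -/
theorem rpow_le_expected_copies (H : Digraph V) {a θ δ ε x : ℝ} (ha : 0 < a)
    (hθ : θ = fracArboricity H / a) (hθ1 : θ < 1) (hδ : δ * Fintype.card V = (1 - θ) / 2)
    (hδ0 : 0 ≤ δ) (hε : ε = (1 - θ) / 2) (hx : 1 ≤ x) {N : ℕ} (hN : x ^ (1 - δ) ≤ N)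
    {S : Finset V} (hS : 2 ≤ #S) :
    x ^ (1 + ε) ≤ (N : ℝ) ^ #S * (x ^ (-1 / a)) ^ #(arcsIn H S) := by
  have hx0 : 0 < x := by linarith
  have h2 : (2 : ℝ) ≤ #S := by exact_mod_cast hS
  have hSh : (#S : ℝ) ≤ Fintype.card V := by exact_mod_cast card_le_univ S
  have hE := card_arcsIn_le H hS
  have hEa : (#(arcsIn H S) : ℝ) / a ≤ θ * ((#S : ℝ) - 1) := by
    rw [hθ, div_mul_eq_mul_div]
    gcongr
  have hδS := mul_le_mul_of_nonneg_left hSh hδ0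
  -- The exponent is at least |S| - δh - θ(|S| - 1) = 1 + (1 - θ)(|S| - 1) - (1 - θ)/2, which is at
  -- least 1 + ε since |S| ≥ 2.
  calc x ^ (1 + ε) ≤ x ^ ((1 - δ) * #S + (-1 / a) * #(arcsIn H S)) := by
        refine Real.rpow_le_rpow_of_exponent_le hx ?_
        have e : (-1 / a) * (#(arcsIn H S) : ℝ) = -(#(arcsIn H S) / a) := by ring
        rw [e]
        nlinarith
    _ = (x ^ (1 - δ)) ^ #S * (x ^ (-1 / a)) ^ #(arcsIn H S) := by
        rw [Real.rpow_add hx0, Real.rpow_mul hx0.le, Real.rpow_mul hx0.le, Real.rpow_natCast,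
          Real.rpow_natCast]
    _ ≤ _ := by gcongr

theorem tendsto_rpow_natCast_atTop {ε : ℝ} (hε : 0 < ε) :
    Tendsto (fun n : ℕ => (n : ℝ) ^ ε) atTop atTop :=
  (tendsto_rpow_atTop hε).comp tendsto_natCast_atTop_atTop

theorem tendsto_pow_mul_exp_neg {ε κ : ℝ} (hε : 0 < ε) (hκ : 0 < κ) (h : ℕ) :
    Tendsto (fun n : ℕ => (n : ℝ) ^ (h * n) * Real.exp (-(κ * (n : ℝ) ^ (1 + ε)))) atTop
      (𝓝 0) := by
  -- This makes h n log n at most half of κ n^(1+ε); the other half eventually exceeds n. Using h +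
  -- 1 avoids dividing by zero.
  have h1 : ∀ᶠ n : ℕ in atTop, Real.log n ≤ (κ / (2 * (h + 1))) * (n : ℝ) ^ ε := by
    have := (isLittleO_log_rpow_atTop hε).bound (show 0 < κ / (2 * ((h : ℝ) + 1)) by positivity)
    filter_upwards [tendsto_natCast_atTop_atTop.eventually this] with n hn
    rw [Real.norm_of_nonneg (by positivity : (0 : ℝ) ≤ (n : ℝ) ^ ε)] at hn
    exact (le_abs_self _).trans hn
  have h2 := (tendsto_rpow_natCast_atTop hε).eventually_ge_atTop (2 / κ)
  have h3 : Tendsto (fun n : ℕ => Real.exp (-(n : ℝ))) atTop (𝓝 0) :=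
    Real.tendsto_exp_neg_atTop_nhds_zero.comp tendsto_natCast_atTop_atTop
  refine squeeze_zero' (Eventually.of_forall fun n => by positivity) ?_ h3
  filter_upwards [h1, h2, eventually_ge_atTop 1] with n hn1 hn2 hn
  have hn0 : (0 : ℝ) < n := by exact_mod_cast hn
  have e1 : (n : ℝ) ^ (h * n) = Real.exp (Real.log n * (h * n)) := by
    rw [← Nat.cast_mul, mul_comm (Real.log _), ← Real.log_pow, Real.exp_log (by positivity)]
  have e2 : (n : ℝ) ^ (1 + ε) = n * (n : ℝ) ^ ε := by
    rw [Real.rpow_add hn0, Real.rpow_one]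
  rw [e1, ← Real.exp_add, Real.exp_le_exp, e2]
  generalize (n : ℝ) ^ ε = y at *
  have hy : 2 ≤ κ * y := by rwa [div_le_iff₀' hκ] at hn2
  have h4 : Real.log n * h ≤ κ * y / 2 := by
    have hy0 : 0 ≤ κ * y := by linarith
    calc Real.log n * h ≤ (κ / (2 * (h + 1)) * y) * h := by gcongr
      _ = (κ * y / 2) * (h / (h + 1)) := by field_simp
      _ ≤ (κ * y / 2) * 1 := by
          gcongr
          rw [div_le_one (by positivity)]
          linarith
      _ = κ * y / 2 := mul_one _
  nlinarith

/-- Of the slack n^δ left by N, one factor n^(δ/2) pays for the r-dependent halvings, as c h² = δ/2,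
and the other for the constant 2^(h²)·h together with the rounding of N. -/
theorem eventually_blocks_fit {δ c : ℝ} (hδ : 0 < δ) (hδ1 : δ ≤ 1) {h : ℕ} (hh : 0 < h)
    (hc : c * h ^ 2 = δ / 2) :
    ∀ᶠ n : ℕ in atTop, ∀ r : ℕ, (r : ℝ) ≤ c * Real.logb 2 n →
      2 ^ ((r + 1) * h ^ 2) * (h * ⌈(n : ℝ) ^ (1 - δ)⌉₊) ≤ n := by
  have h2 := (tendsto_rpow_natCast_atTop (half_pos hδ)).eventually_ge_atTop
    ((2 : ℝ) ^ (h ^ 2) * h * 2)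
  filter_upwards [h2, eventually_ge_atTop 1] with n hn2 hn r hr
  have hn1 : (1 : ℝ) ≤ n := by exact_mod_cast hn
  have hn0 : (0 : ℝ) < n := by linarith
  have hN : (⌈(n : ℝ) ^ (1 - δ)⌉₊ : ℝ) ≤ 2 * (n : ℝ) ^ (1 - δ) := by
    have h1 : 1 ≤ (n : ℝ) ^ (1 - δ) := Real.one_le_rpow hn1 (by linarith)
    have := Nat.ceil_lt_add_one (show 0 ≤ (n : ℝ) ^ (1 - δ) by linarith)
    linarith
  have hpow : (2 : ℝ) ^ (r * h ^ 2) ≤ (n : ℝ) ^ (δ / 2) := by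
    rw [← Real.rpow_natCast, ← hc]
    have e : (n : ℝ) ^ (c * h ^ 2 : ℝ) = (2 : ℝ) ^ (Real.logb 2 n * (c * h ^ 2)) := by
      rw [Real.rpow_mul (by norm_num : (0 : ℝ) ≤ 2), Real.rpow_logb (by norm_num) (by norm_num) hn0]
    rw [e]
    refine Real.rpow_le_rpow_of_exponent_le (by norm_num) ?_
    push_cast
    have := mul_le_mul_of_nonneg_right hr (sq_nonneg (h : ℝ))
    linarith
  have key : (2 : ℝ) ^ ((r + 1) * h ^ 2) * (h * ⌈(n : ℝ) ^ (1 - δ)⌉₊) ≤ n := by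
    calc (2 : ℝ) ^ ((r + 1) * h ^ 2) * (h * ⌈(n : ℝ) ^ (1 - δ)⌉₊)
        = 2 ^ (r * h ^ 2) * (2 ^ (h ^ 2) * h * ⌈(n : ℝ) ^ (1 - δ)⌉₊) := by
          rw [add_mul, one_mul, pow_add]
          ring
      _ ≤ (n : ℝ) ^ (δ / 2) * (2 ^ (h ^ 2) * h * (2 * (n : ℝ) ^ (1 - δ))) := by gcongr
      _ = (n : ℝ) ^ (δ / 2) * ((2 ^ (h ^ 2) * h * 2) * (n : ℝ) ^ (1 - δ)) := by ring
      _ ≤ (n : ℝ) ^ (δ / 2) * ((n : ℝ) ^ (δ / 2) * (n : ℝ) ^ (1 - δ)) := by gcongr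
      _ = n := by
          rw [← Real.rpow_add hn0, ← Real.rpow_add hn0]
          convert! Real.rpow_one (n : ℝ) using 2
          ring
  exact_mod_cast key

theorem exists_tendsto_randDigraphProb {H : Digraph V} (hH : IsDag H) (hm : 0 < #(arcs H))
    {a : ℝ} (ha : fracArboricity H < a) :
    ∃ c : ℝ, 0 < c ∧
      Tendsto (fun n : ℕ => randDigraphProb n ((n : ℝ) ^ (-1 / a)) fun G =>
          ∀ X : Finset (Equiv.Perm (Fin n)), (#X : ℝ) ≤ c * Real.logb 2 n →
            ∃ φ : Copy H G, ∀ π ∈ X, φ.numCovered π ≤ skewness H)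
        atTop (𝓝 1) := by
  have hV := two_le_card_of_isDag hH hm
  have hV' : (2 : ℝ) ≤ Fintype.card V := by exact_mod_cast hV
  have ha0 : 0 < a := (fracArboricity_nonneg H).trans_lt ha
  have hθ0 : 0 ≤ fracArboricity H / a := div_nonneg (fracArboricity_nonneg H) ha0.le
  have hθ1 : fracArboricity H / a < 1 := (div_lt_one ha0).2 ha
  set θ := fracArboricity H / a with hθ
  -- Shrinking blocks to n^(1-δ) loses at most n^(δh), which is half of the gain n^(1-θ) available
  -- from a > a(H).
  set δ := (1 - θ) / (2 * Fintype.card V) with hδ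
  have hδ0 : 0 < δ := div_pos (by linarith) (by linarith)
  have hδ1 : δ ≤ 1 := by
    rw [hδ, div_le_one (by linarith)]
    linarith
  have hδV : δ * Fintype.card V = (1 - θ) / 2 := by
    rw [hδ]
    field_simp
  have hε0 : 0 < (1 - θ) / 2 := by linarith
  have hfit := eventually_blocks_fit (c := δ / (2 * Fintype.card V ^ 2)) hδ0 hδ1
    (h := Fintype.card V) (by omega) (by field_simp)
  have hκ : (0 : ℝ) < 1 / 2 ^ (Fintype.card V + 2) := by positivity
  have hlim := (tendsto_pow_mul_exp_neg hε0 hκ (Fintype.card V)).const_sub 1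
  rw [sub_zero] at hlim
  refine ⟨δ / (2 * Fintype.card V ^ 2), by positivity, ?_⟩
  refine tendsto_of_tendsto_of_tendsto_of_le_of_le' hlim tendsto_const_nhds ?_ ?_
  · filter_upwards [hfit, eventually_ge_atTop 1] with n hn hn1
    have hn1' : (1 : ℝ) ≤ n := by exact_mod_cast hn1
    have hp0 : 0 < (n : ℝ) ^ (-1 / a) := by positivity
    have hp1 : (n : ℝ) ^ (-1 / a) ≤ 1 :=
      Real.rpow_le_one_of_one_le_of_nonpos hn1' (div_nonpos_of_nonpos_of_nonneg (by norm_num) ha0.le)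
    refine le_trans ?_ (one_sub_le_randDigraphProb hH hV (N := ⌈(n : ℝ) ^ (1 - δ)⌉₊) hp0 hp1
      (Y := (n : ℝ) ^ (1 + (1 - θ) / 2)) (by positivity)
      (fun S hS => rpow_le_expected_copies H ha0 hθ hθ1 hδV hδ0.le rfl hn1' (Nat.le_ceil _) hS)
      fun E hE X hX => exists_copy_numCovered_le_skewness H hE X (hn _ hX))
    -- The crude bound N ≤ n suffices in counting block families, because the failure exponent is
    -- superlinear in n.
    have hNn : ⌈(n : ℝ) ^ (1 - δ)⌉₊ ≤ n := by
      rw [Nat.ceil_le]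
      simpa using Real.rpow_le_rpow_of_exponent_le hn1' (show 1 - δ ≤ 1 by linarith)
    rw [one_div_mul_eq_div]
    gcongr
  · filter_upwards [eventually_ge_atTop 1] with n hn1
    have hn1' : (1 : ℝ) ≤ n := by exact_mod_cast hn1
    exact randDigraphProb_le_one n (by positivity) (Real.rpow_le_one_of_one_le_of_nonpos hn1'
      (div_nonpos_of_nonpos_of_nonneg (by norm_num) ha0.le)) _

end

end DagCover

theorem theorem3 :
    ∃ K : ℝ, ∀ (V : Type) [Fintype V] (H : Digraph V),
      DagCover.IsDag H → DagCover.NoIsolatedVertex H → 2 ≤ #(DagCover.arcs H) →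
      ¬ DagCover.IsRootedStar H →
      |(DagCover.skewness H : ℝ) - (#(DagCover.arcs H) : ℝ) / 2| ≤
          K * (#(DagCover.arcs H) : ℝ) ^ (4 / 5 : ℝ) * (Fintype.card V : ℝ) ^ (1 / 5 : ℝ) ∧
      DagCover.skewness H < #(DagCover.arcs H) ∧
      ∀ a : ℝ, DagCover.fracArboricity H < a →
        ∃ c : ℝ, 0 < c ∧
          Tendsto (fun n : ℕ => DagCover.randDigraphProb n ((n : ℝ) ^ (-1 / a)) fun G =>
              ∀ X : Finset (Equiv.Perm (Fin n)), (#X : ℝ) ≤ c * Real.logb 2 n →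
                ∃ φ : DagCover.Copy H G, ∀ π ∈ X, φ.numCovered π ≤ DagCover.skewness H)
            atTop (𝓝 1) := by
  refine ⟨7, fun V _ H hH hiso hm hstar => ?_⟩
  have hm0 : 0 < #(DagCover.arcs H) := by omega
  exact ⟨DagCover.skewness_sub_half_le hH hiso hm0,
    DagCover.skewness_lt_card_arcs hH hiso hm0 hstar,
    fun a ha => DagCover.exists_tendsto_randDigraphProb hH hm0 ha⟩
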